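/- Let $R$ be a subring of $\mathbb{Q}$. A group homomorphism is called 2-connected on $R$-homology if it induces an isomorphism on $H_1(-;R)$ and a surjection on $H_2(-;R)$. Let $\Omega^R$ be the class of homomorphisms $\pi\to G$ that are 2-connected on $R$-homology, with $\pi$ finitely generated and $G$ finitely presented. Let $\mathcal{G}^R$ be the category of finitely presented groups and homomorphisms that are 2-connected on $R$-homology. An I-functor $(\mathcal{H},p)$ with respect to $R$-coefficients associates a homomorphism $p_G\colon G\to\mathcal{H}(G)$ to every group $G$, and a homomorphism $\mathcal{H}(\alpha)\colon\mathcal{H}(\pi)\to\mathcal{H}(G)$ to every homomorphism $\alpha\colon\pi\to G$ in some class of homomorphisms that contains $\Omega^R$ and all isomorphisms. It is required that $\mathcal{H}(\alpha)$ is injective if $\alpha\in\Omega^R$, that $\mathcal{H}(\alpha)$ is an isomorphism if $\alpha$ is one, and that $\mathcal{H}(\beta\circ\alpha)=\mathcal{H}(\beta)\circ\mathcal{H}(\alpha)$, $\mathcal{H}(\mathrm{id}_G)=\mathrm{id}_{\mathcal{H}(G)}$ and $\mathcal{H}(\alpha)\circ p_\pi=p_G\circ\alpha$ whenever the homomorphisms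 involved exist. In particular $\mathcal{H}$ restricts to a functor from $\mathcal{G}^R$ to groups. A morphism $\tau\colon(\mathcal{H},p)\to(\mathcal{H}',p')$ of I-functors is a natural transformation between these functors on $\mathcal{G}^R$ such that $\tau_G\circ p_G=p'_G$ for all finitely presented $G$; it is injective if every $\tau_G$ is. A container of $\mathcal{H}$ is an injective morphism $\sigma\colon\mathcal{H}\to\mathcal{F}$ of I-functors such that $\mathcal{F}(\alpha)$ is an isomorphism for every $\alpha\in\Omega^R$. The I-functor $\mathcal{H}$ commutes with limits if for every sequence $G_0\to G_1\to\cdots$ in $\mathcal{G}^R$ with direct limit $\varinjlim G_k$ in the category of groups, $\mathcal{H}$ associates homomorphisms $\mathcal{H}(G_k)\to\mathcal{H}(\varinjlim G_k)$ to the maps $G_k\to\varinjlim G_k$, and the induced map $\varinjlim\mathcal{H}(G_k)\to\mathcal{H}(\varinjlim G_k)$ is an isomorphism. An $R$-nullhomologous system over a group $A$ is a finite system of equations $x_i^e=w_i(x_1,\dots,x_n)$, $i=1,\dots,n$, where $e$ is the denominator of the reduced expression of an element of $R$ and each $w_i$ is an element of the free product $A*F$ of $A$ with the free group $F$ on $x_1,\dots,x_n$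 that becomes trivial under the projection $A*F\to F\to F/[F,F]$. The group $A$ is $R$-closed if every $R$-nullhomologous system over $A$ has a unique solution in $A$. An $R$-closure of a group $G$ is an initial object $i_G\colon G\to\widehat G$ in the category of homomorphisms of $G$ into $R$-closed groups. **Theorem.** Let $R$ be a subring of $\mathbb{Q}$ and let $(\mathcal{H},p)$ be an I-functor with respect to $R$-coefficients that commutes with limits. Then $R$-closures $i_G\colon G\to\widehat G$ exist for all groups $G$ and can be chosen as a functor with a natural transformation $i$ from the identity functor. For every such choice, $\widehat\alpha\colon\widehat\pi\to\widehat G$ is an isomorphism for every $\alpha\colon\pi\to G$ in $\Omega^R$, so that $\widehat{\mathcal{H}}(G)=\mathcal{H}(\widehat G)$, $\widehat p_G=p_{\widehat G}\circ i_G$, $\widehat{\mathcal{H}}(\alpha)=\mathcal{H}(\widehat\alpha)$ (whenever $\mathcal{H}(\widehat\alpha)$ exists) is an I-functor; $\mathcal{H}(i_G)$ exists for every finitely presented group $G$; and $\tau_G=\mathcal{H}(i_G)\colon\mathcal{H}(G)\to\widehat{\mathcal{H}}(G)$ defines a universal container $\tau\colon\mathcal{H}\to\widehat{\mathcal{H}}$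 of $\mathcal{H}$. That is, $\tau$ is a container, and for every container $\sigma\colon\mathcal{H}\to\mathcal{F}$ there is a unique injective morphism $\widehat\sigma\colon\widehat{\mathcal{H}}\to\mathcal{F}$ with $\widehat\sigma\circ\tau=\sigma$. -/

import Mathlib

open CategoryTheory CategoryTheory.Limits

universe u

noncomputable section

/-! ### Homology with coefficients in a subring of the rationals -/

/-- The coefficient ring `R`, lifted to the universe of the groups under consideration. -/
abbrev CoeffRing (R : Subring ℚ) : Type u := ULift.{u} R

/-- The coefficient ring as a trivial `G`-module. -/
abbrev trivialCoeff (R : Subring ℚ) (G : Type u) [Group G] :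
    Rep.{u} (CoeffRing.{u} R) G :=
  Rep.trivial (CoeffRing.{u} R) G (CoeffRing.{u} R)

/-- The group homology `H_n(G; R)` with trivial coefficients. -/
abbrev homologyWith (R : Subring ℚ) (G : Type u) [Group G] (n : ℕ) :
    ModuleCat.{u} (CoeffRing.{u} R) :=
  groupHomology (trivialCoeff R G) n

/-- The identity of the coefficients, as a map from the trivial `G`-module `R` to the
restriction along `f : G → H` of the trivial `H`-module `R`. -/
def trivialCoeffMap (R : Subring ℚ) {G H : Type u} [Group G] [Group H] (f : G →* H) :
    trivialCoeff R G ⟶ Rep.res f (trivialCoeff R H) :=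
  Rep.ofHom ⟨LinearMap.id, fun _ => rfl⟩

/-- The map `H_n(G; R) → H_n(H; R)` induced by a group homomorphism. -/
def homologyMapWith (R : Subring ℚ) {G H : Type u} [Group G] [Group H] (f : G →* H) (n : ℕ) :
    homologyWith R G n ⟶ homologyWith R H n :=
  groupHomology.map f (trivialCoeffMap R f) n

theorem homologyMapWith_id (R : Subring ℚ) (G : Type u) [Group G] (n : ℕ) :
    homologyMapWith R (MonoidHom.id G) n = 𝟙 _ :=
  groupHomology.map_id (A := trivialCoeff R G) n

theorem homologyMapWith_comp (R : Subring ℚ) {G H K : Type u} [Group G] [Group H] [Group K]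
    (f : G →* H) (g : H →* K) (n : ℕ) :
    homologyMapWith R (g.comp f) n = homologyMapWith R f n ≫ homologyMapWith R g n :=
  groupHomology.map_comp f g (trivialCoeffMap R f) (trivialCoeffMap R g) n

/-- A homomorphism is 2-connected on `R`-homology if it induces an isomorphism on `H_1(-; R)`
and a surjection on `H_2(-; R)`. -/
def TwoConnected (R : Subring ℚ) : MorphismProperty GrpCat.{u} := fun _ _ α =>
  Function.Bijective (homologyMapWith R α.hom 1) ∧
    Function.Surjective (homologyMapWith R α.hom 2)

instance (R : Subring ℚ) : (TwoConnected.{u} R).IsMultiplicative where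
  id_mem G := by
    have h : ∀ n, ⇑(homologyMapWith R (𝟙 G : G ⟶ G).hom n) = id := by
      intro n
      funext x
      rw [GrpCat.hom_id, homologyMapWith_id]
      rfl
    exact ⟨by rw [h]; exact Function.bijective_id, by rw [h]; exact Function.surjective_id⟩
  comp_mem {G H K} f g hf hg := by
    have h : ∀ n, ⇑(homologyMapWith R (f ≫ g).hom n) =
        ⇑(homologyMapWith R g.hom n) ∘ ⇑(homologyMapWith R f.hom n) := by
      intro n
      funext x
      rw [GrpCat.hom_comp, homologyMapWith_comp]
      rfl
    exact ⟨by rw [h]; exact hg.1.comp hf.1, by rw [h]; exact hg.2.comp hf.2⟩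

/-- The class `Ω^R` of homomorphisms `π → G`, 2-connected on `R`-homology, with `π` finitely
generated and `G` finitely presented. -/
def Omega (R : Subring ℚ) : MorphismProperty GrpCat.{u} := fun π G α =>
  Group.FG π ∧ Group.IsFinitelyPresented G ∧ TwoConnected R α

/-- The category `𝒢^R`: its objects are the finitely presented groups, its morphisms are the
homomorphisms that are 2-connected on `R`-homology. -/
abbrev GR (R : Subring ℚ) :=
  InducedWideCategory GrpCat.{u}
    (fun G : {G : GrpCat.{u} // Group.IsFinitelyPresented G} => G.1) (TwoConnected.{u} R)

/-- The inclusion of `𝒢^R` into the category of groups. -/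
abbrev GRincl (R : Subring ℚ) : GR.{u} R ⥤ GrpCat.{u} :=
  wideInducedFunctor (fun G : {G : GrpCat.{u} // Group.IsFinitelyPresented G} => G.1)
    (TwoConnected.{u} R)

theorem omega_of_GR {R : Subring ℚ} {G H : GR.{u} R} (α : G ⟶ H) :
    Omega R ((GRincl R).map α) := by
  refine ⟨?_, H.2, α.property⟩
  obtain ⟨n, φ, hφ, -⟩ := G.2.out
  exact Group.fg_of_surjective hφ

/-! ### I-functors -/

/-- An I-functor with respect to `R`-coefficients. It associates a group `H(G)` and a
homomorphism `p_G : G → H(G)` to each group `G`, and a homomorphism `H(α)` to each homomorphism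
`α` in a class `dom`, the class of those `α` for which `H(α)` exists. The class contains `Ω^R`,
where `H(α)` is injective, and all isomorphisms, where `H(α)` is an isomorphism. The naturality
conditions hold whenever the homomorphisms involved exist. -/
structure IFunctor (R : Subring ℚ) where
  obj : GrpCat.{u} → GrpCat.{u}
  p (G : GrpCat.{u}) : G ⟶ obj G
  dom : MorphismProperty GrpCat.{u}
  map {G H : GrpCat.{u}} (α : G ⟶ H) (hα : dom α) : obj G ⟶ obj H
  dom_of_omega {G H : GrpCat.{u}} (α : G ⟶ H) (hα : Omega R α) : dom α
  dom_of_isIso {G H : GrpCat.{u}} (α : G ⟶ H) (hα : IsIso α) : dom α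
  map_injective {G H : GrpCat.{u}} (α : G ⟶ H) (hα : Omega R α) :
    Function.Injective (map α (dom_of_omega α hα))
  map_isIso {G H : GrpCat.{u}} (α : G ⟶ H) (hα : IsIso α) : IsIso (map α (dom_of_isIso α hα))
  map_id (G : GrpCat.{u}) (h : dom (𝟙 G)) : map (𝟙 G) h = 𝟙 (obj G)
  map_comp {G H K : GrpCat.{u}} (α : G ⟶ H) (β : H ⟶ K) (hα : dom α) (hβ : dom β)
    (hαβ : dom (α ≫ β)) : map (α ≫ β) hαβ = map α hα ≫ map β hβ
  p_naturality {G H : GrpCat.{u}} (α : G ⟶ H) (hα : dom α) : α ≫ p H = p G ≫ map α hα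

namespace IFunctor

variable {R : Subring ℚ}

theorem map_congr (H : IFunctor.{u} R) {G K : GrpCat.{u}} {α β : G ⟶ K} (h : α = β)
    (hα : H.dom α) (hβ : H.dom β) : H.map α hα = H.map β hβ := by
  subst h
  rfl

/-- The functor `𝒢^R → 𝒢` induced by an I-functor. -/
@[simps]
def toFunctor (H : IFunctor.{u} R) : GR.{u} R ⥤ GrpCat.{u} where
  obj G := H.obj ((GRincl R).obj G)
  map α := H.map ((GRincl R).map α) (H.dom_of_omega _ (omega_of_GR α))
  map_id G := H.map_id _ _
  map_comp α β := H.map_comp _ _ _ _ _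

/-- A morphism of I-functors: a natural transformation between the induced functors on `𝒢^R`
that is compatible with the homomorphisms `p_G`. -/
@[ext]
structure Hom (H H' : IFunctor.{u} R) where
  app (G : GR.{u} R) : H.obj ((GRincl R).obj G) ⟶ H'.obj ((GRincl R).obj G)
  naturality {G K : GR.{u} R} (α : G ⟶ K) :
    H.toFunctor.map α ≫ app K = app G ≫ H'.toFunctor.map α
  p_comp (G : GR.{u} R) : H.p ((GRincl R).obj G) ≫ app G = H'.p ((GRincl R).obj G)

instance : Category (IFunctor.{u} R) where
  Hom := Hom
  id H :=
    { app := fun _ => 𝟙 _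
      naturality := fun α =>
        (Category.comp_id (H.toFunctor.map α)).trans (Category.id_comp (H.toFunctor.map α)).symm
      p_comp := fun _ => Category.comp_id _ }
  comp {H H' H''} τ σ :=
    { app := fun G => τ.app G ≫ σ.app G
      naturality := fun {G K} α =>
        (Category.assoc (H.toFunctor.map α) (τ.app K) (σ.app K)).symm.trans <|
          (congrArg (· ≫ σ.app K) (τ.naturality α)).trans <|
          (Category.assoc (τ.app G) (H'.toFunctor.map α) (σ.app K)).trans <|
          (congrArg (τ.app G ≫ ·) (σ.naturality α)).trans
            (Category.assoc (τ.app G) (σ.app G) (H''.toFunctor.map α)).symm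
      p_comp := fun G => by rw [← Category.assoc, τ.p_comp, σ.p_comp] }
  id_comp _ := Hom.ext (funext fun _ => Category.id_comp _)
  comp_id _ := Hom.ext (funext fun _ => Category.comp_id _)
  assoc _ _ _ := Hom.ext (funext fun _ => Category.assoc _ _ _)

/-- The component `τ_G : H(G) → H'(G)` of a morphism of I-functors. -/
def app {H H' : IFunctor.{u} R} (τ : H ⟶ H') (G : GR.{u} R) :
    H.obj ((GRincl R).obj G) ⟶ H'.obj ((GRincl R).obj G) :=
  Hom.app τ G

/-- A morphism of I-functors is injective if each `τ_G` is. -/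
def IsInjective {H H' : IFunctor.{u} R} (τ : H ⟶ H') : Prop :=
  ∀ G : GR.{u} R, Function.Injective (app τ G)

/-- A container of `H` is an injective morphism `τ : H → F` of I-functors such that `F(α)` is an
isomorphism for every `α` in `Ω^R`. -/
def IsContainer {H F : IFunctor.{u} R} (τ : H ⟶ F) : Prop :=
  IsInjective τ ∧
    ∀ {π G : GrpCat.{u}} (α : π ⟶ G) (hα : Omega R α), IsIso (F.map α (F.dom_of_omega α hα))

/-- A container `τ : H → F` is universal if for every container `σ : H → F'` there is a unique
injective morphism `F → F'` whose composition with `τ` is `σ`. -/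
def IsUniversalContainer {H F : IFunctor.{u} R} (τ : H ⟶ F) : Prop :=
  IsContainer τ ∧
    ∀ (F' : IFunctor.{u} R) (σ : H ⟶ F'), IsContainer σ →
      ∃! σ' : F ⟶ F', IsInjective σ' ∧ τ ≫ σ' = σ

/-- For a sequence `G_0 → G_1 → ⋯` in `𝒢^R` and a cocone `G_k → L` of groups such that
`H(G_k) → H(L)` exists for all `k`, the cocone of the `H(G_k) → H(L)`. -/
def mapCocone (H : IFunctor.{u} R) (X : ℕ ⥤ GR.{u} R) (c : Cocone (X ⋙ GRincl R))
    (hc : ∀ k, H.dom (c.ι.app k)) : Cocone (X ⋙ H.toFunctor) where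
  pt := H.obj c.pt
  ι :=
    { app := fun k => H.map (c.ι.app k) (hc k)
      naturality := fun i j f => by
        have hw : (GRincl R).map (X.map f) ≫ c.ι.app j = c.ι.app i := c.w f
        have h := H.map_comp ((GRincl R).map (X.map f)) (c.ι.app j)
          (H.dom_of_omega _ (omega_of_GR _)) (hc j) (hw ▸ hc i)
        exact (h.symm.trans (H.map_congr hw _ (hc i))).trans (Category.comp_id _).symm }

/-- An I-functor commutes with limits if for every sequence `G_0 → G_1 → ⋯` in `𝒢^R` with direct
limit `L` in the category of groups, `H` associates a homomorphism `H(G_k) → H(L)` to each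
`G_k → L`, and these exhibit `H(L)` as the direct limit of the `H(G_k)`. -/
def CommutesWithLimits (H : IFunctor.{u} R) : Prop :=
  ∀ (X : ℕ ⥤ GR.{u} R) (c : Cocone (X ⋙ GRincl R)), IsColimit c →
    ∃ hc : ∀ k, H.dom (c.ι.app k), Nonempty (IsColimit (H.mapCocone X c hc))

/-- The I-functor `G ↦ H(E(G))`, with `p_{E(G)} ∘ i_G : G → H(E(G))`, for a functor `E` from
groups to groups that turns the homomorphisms in `Ω^R` into isomorphisms and a natural
transformation `i` from the identity to `E`. -/
def precomp (H : IFunctor.{u} R) (E : GrpCat.{u} ⥤ GrpCat.{u}) (i : 𝟭 GrpCat.{u} ⟶ E)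
    (hE : ∀ (π G : GrpCat.{u}) (α : π ⟶ G), Omega R α → IsIso (E.map α)) : IFunctor.{u} R where
  obj G := H.obj (E.obj G)
  p G := i.app G ≫ H.p (E.obj G)
  dom := fun _ _ α => H.dom (E.map α)
  map α hα := H.map (E.map α) hα
  dom_of_omega α hα := H.dom_of_isIso _ (hE _ _ α hα)
  dom_of_isIso α hα := H.dom_of_isIso _ inferInstance
  map_injective α hα := by
    have := H.map_isIso (E.map α) (hE _ _ α hα)
    exact (GrpCat.mono_iff_injective _).1 inferInstance
  map_isIso α hα := H.map_isIso (E.map α) inferInstance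
  map_id G h := by
    rw [H.map_congr (E.map_id G) h (H.dom_of_isIso _ inferInstance), H.map_id]
  map_comp α β hα hβ hαβ := by
    rw [H.map_congr (E.map_comp α β) hαβ (E.map_comp α β ▸ hαβ), H.map_comp _ _ hα hβ]
  p_naturality {G K} α hα := by
    have h : α ≫ i.app K = i.app G ≫ E.map α := i.naturality α
    rw [← Category.assoc, h, Category.assoc, Category.assoc, H.p_naturality (E.map α) hα]

end IFunctor

/-! ### `R`-closures -/

open Monoid.Coprod in
/-- An `R`-nullhomologous system of equations `x_i ^ e = w_i(x_1, …, x_n)` over `A`: the exponent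
`e` is the denominator of the reduced expression of an element of `R`, and each `w_i` is an
element of the free product of `A` and the free group `F` on `x_1, …, x_n` that is sent to the
trivial element by the projection to `F / [F, F]`. -/
structure NullSystem (R : Subring ℚ) (A : Type u) [Group A] where
  n : ℕ
  e : ℕ
  e_mem : ∃ q ∈ R, q.den = e
  w : Fin n → A ∗ FreeGroup (Fin n)
  null (i : Fin n) : Abelianization.of (Monoid.Coprod.snd (w i)) = 1

/-- `a` solves the system if `a_i ^ e = w_i(a_1, …, a_n)` for all `i`. -/
def NullSystem.IsSolution {R : Subring ℚ} {A : Type u} [Group A] (S : NullSystem R A)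
    (a : Fin S.n → A) : Prop :=
  ∀ i, a i ^ S.e = Monoid.Coprod.lift (MonoidHom.id A) (FreeGroup.lift a) (S.w i)

/-- A group is `R`-closed if every `R`-nullhomologous system over it has a unique solution. -/
def IsRClosed (R : Subring ℚ) (A : Type u) [Group A] : Prop :=
  ∀ S : NullSystem R A, ∃! a : Fin S.n → A, S.IsSolution a

/-- `i : G → K` is an `R`-closure of `G` if it is initial among the homomorphisms of `G` into
`R`-closed groups. -/
def IsRClosure (R : Subring ℚ) {G K : GrpCat.{u}} (i : G ⟶ K) : Prop :=
  IsRClosed R K ∧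
    ∀ (A : GrpCat.{u}), IsRClosed R A → ∀ φ : G ⟶ A, ∃! ψ : K ⟶ A, i ≫ ψ = φ

end

/-!
The proof rests on two classes of homomorphisms that are orthogonal to each other. A homomorphism
`p : E → B` is relatively `R`-closed if solutions in `B` of `R`-nullhomologous systems over `E`
lift uniquely to `E`; examples are the map from an `R`-closed group to the trivial group, an
`R`-module over the trivial group, and every central extension by an `R`-module, because changing
the unknowns by central elements does not affect the words of such a system
(`isRelativelyClosed_of_central`). Adjoining a solution of a system to a group, or identifying two
solutions, gives homomorphisms that are left orthogonal to all of these. Lifting in modules and in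
central extensions shows that left orthogonal homomorphisms are 2-connected on `R`-homology
(`LeftOrthogonal.twoConnected`).

Conversely, homomorphisms into `R`-closed groups extend uniquely along each `α : π → G` in `Ω^R`
(`Omega.existsUnique_extension`). Surjectivity on `H_1` provides a system over `π` that the
generators of `G` solve, so that `α` factors as `π → P → G`, where a solution is adjoined in `P`
and `r : P → G` is onto. The kernel `K` of `r` is finitely normally generated, and the five term
exact sequence shows that `K / [P, K] ⊗ R = 0`. Hence generators of `K` solve a system over `P` of
which the trivial tuple is a solution too, so that `K` dies in every `R`-closed group. It follows
that `R`-closure turns `Ω^R` into isomorphisms.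

The `R`-closure of an arbitrary group is built syntactically, from expressions in the elements of
the group and formal solutions of systems, up to equality of their values in all `R`-closed groups
(`RClosure`). For a finitely presented group `G`, one also adjoins and identifies solutions one
system at a time, in a dovetailed order; this exhibits `G → Ĝ` as the map into the direct limit of a
sequence in `𝒢^R` (`IsRClosure.nonempty_sequentialClosure`). An I-functor `H` that commutes with
limits is therefore defined on `G → Ĝ` and injective there, and `H(Ĝ)` is the direct limit of the
`H(G_k)`. Each object of `𝒢^R` under `G` maps to some `G_k`, because finitely presented groups are
compact, and so a morphism from `H` to an I-functor that inverts `Ω^R` extends uniquely to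
`G ↦ H(Ĝ)` (`existsUnique_extension_of_sequentialPresentation`).
-/

noncomputable section

/-! ### Chains of the bar complex in low degrees -/

section Chains

variable (k : Type u) [CommRing k] (G : Type u) [Group G]

/-- The boundary map from 2-chains to 1-chains of the bar complex of `G` with trivial
coefficients. -/
def barBoundary₂ : (G × G →₀ k) →ₗ[k] (G →₀ k) :=
  Finsupp.linearCombination k fun g =>
    Finsupp.single g.2 1 - Finsupp.single (g.1 * g.2) 1 + Finsupp.single g.1 1

/-- The boundary map from 3-chains to 2-chains of the bar complex of `G` with trivial
coefficients. -/
def barBoundary₃ : (G × G × G →₀ k) →ₗ[k] (G × G →₀ k) :=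
  Finsupp.linearCombination k fun g =>
    Finsupp.single (g.2.1, g.2.2) 1 - Finsupp.single (g.1 * g.2.1, g.2.2) 1 +
      Finsupp.single (g.1, g.2.1 * g.2.2) 1 - Finsupp.single (g.1, g.2.1) 1

variable {k G}

@[simp]
theorem barBoundary₂_single (g h : G) (a : k) :
    barBoundary₂ k G (Finsupp.single (g, h) a) =
      Finsupp.single h a - Finsupp.single (g * h) a + Finsupp.single g a := by
  simp [barBoundary₂, Finsupp.linearCombination_single, smul_add, smul_sub]

@[simp]
theorem barBoundary₃_single (g h j : G) (a : k) :
    barBoundary₃ k G (Finsupp.single (g, h, j) a) =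
      Finsupp.single (h, j) a - Finsupp.single (g * h, j) a +
        Finsupp.single (g, h * j) a - Finsupp.single (g, h) a := by
  simp [barBoundary₃, Finsupp.linearCombination_single, smul_add, smul_sub]

theorem barBoundary₂_barBoundary₃ (x : G × G × G →₀ k) :
    barBoundary₂ k G (barBoundary₃ k G x) = 0 := by
  have h : barBoundary₂ k G ∘ₗ barBoundary₃ k G = 0 := by
    ext ⟨g, h, j⟩ : 2
    simp only [LinearMap.comp_apply, Finsupp.lsingle_apply, barBoundary₃_single, map_sub, map_add,
      barBoundary₂_single, mul_assoc, LinearMap.zero_apply]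
    abel
  exact LinearMap.congr_fun h x

variable {H : Type u} [Group H]

theorem mapDomain_barBoundary₂ (f : G →* H) (x : G × G →₀ k) :
    Finsupp.lmapDomain k k f (barBoundary₂ k G x) =
      barBoundary₂ k H (Finsupp.lmapDomain k k (Prod.map f f) x) := by
  have h : Finsupp.lmapDomain k k f ∘ₗ barBoundary₂ k G =
      barBoundary₂ k H ∘ₗ Finsupp.lmapDomain k k (Prod.map f f) := by
    ext ⟨g, h⟩ : 2
    simp only [LinearMap.comp_apply, Finsupp.lsingle_apply, barBoundary₂_single, map_sub, map_add,
      Finsupp.lmapDomain_apply, Finsupp.mapDomain_single, Prod.map, map_mul]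
  exact LinearMap.congr_fun h x

theorem mapDomain_barBoundary₃ (f : G →* H) (x : G × G × G →₀ k) :
    Finsupp.lmapDomain k k (Prod.map f f) (barBoundary₃ k G x) =
      barBoundary₃ k H (Finsupp.lmapDomain k k (Prod.map f (Prod.map f f)) x) := by
  have h : Finsupp.lmapDomain k k (Prod.map f f) ∘ₗ barBoundary₃ k G =
      barBoundary₃ k H ∘ₗ Finsupp.lmapDomain k k (Prod.map f (Prod.map f f)) := by
    ext ⟨g, h, j⟩ : 2
    simp only [LinearMap.comp_apply, Finsupp.lsingle_apply, barBoundary₃_single, map_sub, map_add,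
      Finsupp.lmapDomain_apply, Finsupp.mapDomain_single, Prod.map, map_mul]
  exact LinearMap.congr_fun h x

end Chains

/-! ### Homology in degrees one and two in terms of chains -/

section HomologyChains

variable {R : Subring ℚ} {G H : Type u} [Group G] [Group H]

theorem d₂₁_trivialCoeff (x : G × G →₀ CoeffRing.{u} R) :
    groupHomology.d₂₁ (trivialCoeff R G) x = barBoundary₂ (CoeffRing.{u} R) G x := by
  have h : (groupHomology.d₂₁ (trivialCoeff R G)).hom = barBoundary₂ (CoeffRing.{u} R) G := by
    refine Finsupp.lhom_ext fun g a => ?_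
    obtain ⟨g, h⟩ := g
    rw [barBoundary₂_single]
    exact groupHomology.d₂₁_single (A := trivialCoeff R G) (g, h) a
  exact LinearMap.congr_fun h x

theorem d₃₂_trivialCoeff (x : G × G × G →₀ CoeffRing.{u} R) :
    groupHomology.d₃₂ (trivialCoeff R G) x = barBoundary₃ (CoeffRing.{u} R) G x := by
  have h : (groupHomology.d₃₂ (trivialCoeff R G)).hom = barBoundary₃ (CoeffRing.{u} R) G := by
    refine Finsupp.lhom_ext fun g a => ?_
    obtain ⟨g, h, j⟩ := g
    rw [barBoundary₃_single]
    exact groupHomology.d₃₂_single (A := trivialCoeff R G) (g, h, j) a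
  exact LinearMap.congr_fun h x

theorem chainsMap₁_trivialCoeff (f : G →* H) (x : G →₀ CoeffRing.{u} R) :
    groupHomology.chainsMap₁ f (trivialCoeffMap R f) x =
      Finsupp.lmapDomain _ (CoeffRing.{u} R) f x := by
  change Finsupp.mapRange.linearMap LinearMap.id _ = _
  rw [Finsupp.mapRange.linearMap_id]; rfl

theorem chainsMap₂_trivialCoeff (f : G →* H) (x : G × G →₀ CoeffRing.{u} R) :
    groupHomology.chainsMap₂ f (trivialCoeffMap R f) x =
      Finsupp.lmapDomain _ (CoeffRing.{u} R) (Prod.map f f) x := by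
  change Finsupp.mapRange.linearMap LinearMap.id _ = _
  rw [Finsupp.mapRange.linearMap_id]; rfl

/-- The class in `H_1(G; R)` of a 1-chain; with trivial coefficients every 1-chain is a cycle. -/
def homologyClass₁ (R : Subring ℚ) (G : Type u) [Group G] :
    (G →₀ CoeffRing.{u} R) →ₗ[CoeffRing.{u} R] homologyWith R G 1 :=
  (groupHomology.H1π (trivialCoeff R G)).hom ∘ₗ
    (groupHomology.cycles₁IsoOfIsTrivial (trivialCoeff R G)).inv.hom

theorem homologyClass₁_surjective : Function.Surjective (homologyClass₁ R G) := by
  intro x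
  induction x using groupHomology.H1_induction_on with
  | h x => exact ⟨x.1, rfl⟩

theorem homologyClass₁_eq_zero_iff (x : G →₀ CoeffRing.{u} R) :
    homologyClass₁ R G x = 0 ↔ ∃ y, barBoundary₂ _ G y = x := by
  refine (groupHomology.H1π_eq_zero_iff _).trans ?_
  change (∃ y, _ = _) ↔ _
  exact exists_congr fun y => by rw [← d₂₁_trivialCoeff]; rfl

theorem homologyMapWith_homologyClass₁ (f : G →* H) (x : G →₀ CoeffRing.{u} R) :
    homologyMapWith R f 1 (homologyClass₁ R G x) =
      homologyClass₁ R H (Finsupp.lmapDomain _ (CoeffRing.{u} R) f x) := by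
  refine (groupHomology.H1π_comp_map_apply (f := f) (φ := trivialCoeffMap R f)
    ((groupHomology.cycles₁IsoOfIsTrivial (trivialCoeff R G)).inv x)).trans ?_
  refine congrArg (groupHomology.H1π _) (Subtype.ext ?_)
  rw [← chainsMap₁_trivialCoeff]
  rfl

theorem homologyMapWith_one_injective_iff (f : G →* H) :
    Function.Injective (homologyMapWith R f 1) ↔
      ∀ x : G →₀ CoeffRing.{u} R,
        (∃ y, barBoundary₂ _ H y = Finsupp.lmapDomain _ (CoeffRing.{u} R) f x) →
          ∃ y, barBoundary₂ _ G y = x := by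
  rw [injective_iff_map_eq_zero]
  constructor
  · intro h x hx
    rw [← homologyClass₁_eq_zero_iff] at hx ⊢
    exact h _ (by rw [homologyMapWith_homologyClass₁, hx])
  · intro h x hx
    obtain ⟨x, rfl⟩ := homologyClass₁_surjective x
    rw [homologyMapWith_homologyClass₁, homologyClass₁_eq_zero_iff] at hx
    rw [homologyClass₁_eq_zero_iff]
    exact h x hx

theorem homologyMapWith_one_surjective_iff (f : G →* H) :
    Function.Surjective (homologyMapWith R f 1) ↔
      ∀ x : H →₀ CoeffRing.{u} R, ∃ (z : G →₀ CoeffRing.{u} R) (y : H × H →₀ CoeffRing.{u} R),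
        x = Finsupp.lmapDomain _ (CoeffRing.{u} R) f z + barBoundary₂ _ H y := by
  have key : ∀ (x : H →₀ CoeffRing.{u} R) (z : G →₀ CoeffRing.{u} R),
      homologyMapWith R f 1 (homologyClass₁ R G z) = homologyClass₁ R H x ↔
        ∃ y, x = Finsupp.lmapDomain _ (CoeffRing.{u} R) f z + barBoundary₂ _ H y := by
    intro x z
    rw [homologyMapWith_homologyClass₁, eq_comm, ← sub_eq_zero, ← map_sub,
      homologyClass₁_eq_zero_iff]
    exact exists_congr fun y => ⟨fun h => by rw [h]; abel, fun h => by rw [h]; abel⟩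
  constructor
  · intro h x
    obtain ⟨z, hz⟩ := h (homologyClass₁ R H x)
    obtain ⟨z, rfl⟩ := homologyClass₁_surjective z
    exact ⟨z, (key x z).1 hz⟩
  · intro h x
    obtain ⟨x, rfl⟩ := homologyClass₁_surjective x
    obtain ⟨z, hz⟩ := h x
    exact ⟨_, (key x z).2 hz⟩

theorem homologyMapWith_two_surjective_iff (f : G →* H) :
    Function.Surjective (homologyMapWith R f 2) ↔
      ∀ x : H × H →₀ CoeffRing.{u} R, barBoundary₂ _ H x = 0 →
        ∃ (z : G × G →₀ CoeffRing.{u} R) (y : H × H × H →₀ CoeffRing.{u} R),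
          barBoundary₂ _ G z = 0 ∧
          x = Finsupp.lmapDomain _ (CoeffRing.{u} R) (Prod.map f f) z + barBoundary₃ _ H y := by
  have key : ∀ (x : groupHomology.cycles₂ (trivialCoeff R H))
      (z : groupHomology.cycles₂ (trivialCoeff R G)),
      homologyMapWith R f 2 (groupHomology.H2π _ z) = groupHomology.H2π _ x ↔
        ∃ y, x.1 = Finsupp.lmapDomain _ (CoeffRing.{u} R) (Prod.map f f) z.1 +
          barBoundary₃ _ H y := by
    intro x z
    have h1 : homologyMapWith R f 2 (groupHomology.H2π _ z) = groupHomology.H2π _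
        (groupHomology.mapCycles₂ f (trivialCoeffMap R f) z) :=
      groupHomology.H2π_comp_map_apply (f := f) (φ := trivialCoeffMap R f) z
    rw [h1, eq_comm, groupHomology.H2π_eq_iff, groupHomology.coe_mapCycles₂,
      chainsMap₂_trivialCoeff]
    change (∃ y, groupHomology.d₃₂ (trivialCoeff R H) y = _) ↔ _
    refine exists_congr fun y => ?_
    rw [d₃₂_trivialCoeff, eq_sub_iff_add_eq, add_comm, eq_comm]
  constructor
  · intro h x hx
    obtain ⟨z, hz⟩ := h (groupHomology.H2π _ ⟨x, (d₂₁_trivialCoeff x).trans hx⟩)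
    induction z using groupHomology.H2_induction_on with
    | h z =>
      obtain ⟨y, hy⟩ := (key _ _).1 hz
      exact ⟨z.1, y, (d₂₁_trivialCoeff z.1).symm.trans z.2, hy⟩
  · intro h x
    induction x using groupHomology.H2_induction_on with
    | h x =>
      obtain ⟨z, y, hz, hy⟩ := h x.1 ((d₂₁_trivialCoeff x.1).symm.trans x.2)
      exact ⟨_, (key x ⟨z, (d₂₁_trivialCoeff z).trans hz⟩).2 ⟨y, hy⟩⟩

end HomologyChains

/-! ### Denominators of elements of `R` -/

section Denominators

/-- `e` is the denominator of the reduced expression of an element of `R`. -/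
def IsDenominator (R : Subring ℚ) (e : ℕ) : Prop := ∃ q ∈ R, q.den = e

variable {R : Subring ℚ}

theorem IsDenominator.ne_zero {e : ℕ} (he : IsDenominator R e) : e ≠ 0 := by
  obtain ⟨q, -, rfl⟩ := he
  exact q.den_ne_zero

theorem isDenominator_iff_inv_mem {e : ℕ} : IsDenominator R e ↔ e ≠ 0 ∧ (e : ℚ)⁻¹ ∈ R := by
  constructor
  · intro he
    refine ⟨he.ne_zero, ?_⟩
    obtain ⟨q, hq, rfl⟩ := he
    -- Bézout: if `u * num + v * den = 1` then `1 / den = u * q + v`.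
    obtain ⟨u, v, huv⟩ : IsCoprime q.num (q.den : ℤ) :=
      Int.isCoprime_iff_gcd_eq_one.2 q.reduced
    have hd : (q.den : ℚ) ≠ 0 := by exact_mod_cast q.den_ne_zero
    have h : (q.den : ℚ)⁻¹ = u * q + v := by
      have h1 : (u : ℚ) * q.num + v * q.den = 1 := by exact_mod_cast huv
      have h2 : q * q.den = q.num := Rat.mul_den_eq_num q
      field_simp
      rw [← h1, ← h2]
      ring
    rw [h]
    exact R.add_mem (R.mul_mem (intCast_mem R u) hq) (intCast_mem R v)
  · rintro ⟨he, h⟩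
    refine ⟨_, h, ?_⟩
    rw [Rat.inv_natCast_den, if_neg he]

theorem isDenominator_one (R : Subring ℚ) : IsDenominator R 1 := ⟨0, R.zero_mem, rfl⟩

theorem IsDenominator.mul {e e' : ℕ} (he : IsDenominator R e) (he' : IsDenominator R e') :
    IsDenominator R (e * e') := by
  rw [isDenominator_iff_inv_mem] at *
  refine ⟨mul_ne_zero he.1 he'.1, ?_⟩
  rw [Nat.cast_mul, mul_inv]
  exact R.mul_mem he.2 he'.2

/-- If each of finitely many elements has a power in a subgroup `K` whose exponent is a denominator
of `R`, then there is a common such exponent. -/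
theorem exists_common_denominator {ι : Type*} [Finite ι] {G : Type*} [Group G] (K : Subgroup G)
    (g : ι → G) (h : ∀ i, ∃ e, IsDenominator R e ∧ g i ^ e ∈ K) :
    ∃ e, IsDenominator R e ∧ ∀ i, g i ^ e ∈ K := by
  classical
  have := Fintype.ofFinite ι
  choose e he hK using h
  refine ⟨∏ i, e i, ?_, fun i => ?_⟩
  · exact Finset.prod_induction e (IsDenominator R) (fun _ _ => IsDenominator.mul)
      (isDenominator_one R) fun i _ => he i
  · obtain ⟨d, hd⟩ := Finset.dvd_prod_of_mem e (Finset.mem_univ i)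
    rw [hd, pow_mul]
    exact K.pow_mem (hK i) d

theorem IsDenominator.isUnit {e : ℕ} (he : IsDenominator R e) :
    IsUnit (e : CoeffRing.{u} R) := by
  have h := isDenominator_iff_inv_mem.1 he
  refine IsUnit.of_mul_eq_one (ULift.up ⟨_, h.2⟩) ?_
  apply ULift.ext
  apply Subtype.ext
  change (e : ℚ) * (e : ℚ)⁻¹ = 1
  exact mul_inv_cancel₀ (by exact_mod_cast h.1)

/-- The submonoid of the integers consisting of the denominators of the elements of `R`. -/
def denominators (R : Subring ℚ) : Submonoid ℤ where
  carrier := {z | ∃ e, IsDenominator R e ∧ z = e}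
  one_mem' := ⟨1, isDenominator_one R, rfl⟩
  mul_mem' := by
    rintro _ _ ⟨e, he, rfl⟩ ⟨e', he', rfl⟩
    exact ⟨_, he.mul he', by push_cast; rfl⟩

instance isLocalization_coeffRing : IsLocalization (denominators R) (CoeffRing.{u} R) where
  map_units := by
    rintro ⟨_, e, he, rfl⟩
    simpa using he.isUnit
  surj := by
    rintro ⟨q⟩
    refine ⟨(q.1.num, ⟨q.1.den, q.1.den, ⟨q.1, q.2, rfl⟩, rfl⟩), ?_⟩
    apply ULift.ext
    apply Subtype.ext
    change q.1 * ((q.1.den : ℤ) : ℚ) = ((q.1.num : ℤ) : ℚ)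
    push_cast
    exact Rat.mul_den_eq_num _
  exists_of_eq := by
    intro x y h
    refine ⟨1, ?_⟩
    have h' : (x : ℚ) = y := congrArg (fun z : CoeffRing.{u} R => (z.down : ℚ)) h
    rw [Int.cast_injective h']

attribute [local instance] LocalizedModule.moduleOfIsLocalization in
/-- An element of an abelian group that is annihilated by all homomorphisms to `R`-modules is
annihilated by a denominator of `R`: consider the localization. -/
theorem exists_pow_eq_one_of_forall_hom {C : Type u} [CommGroup C] (c : C)
    (h : ∀ (M : Type u) [AddCommGroup M] [Module (CoeffRing.{u} R) M]
      (θ : C →* Multiplicative M), θ c = 1) :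
    ∃ e, IsDenominator R e ∧ c ^ e = 1 := by
  have h0 : LocalizedModule.mk (Additive.ofMul c) (1 : denominators R) = 0 :=
    h (LocalizedModule (denominators R) (Additive C)) (AddMonoidHom.toMultiplicativeRight
      (LocalizedModule.mkLinearMap (denominators R) (Additive C)).toAddMonoidHom)
  rw [← LocalizedModule.zero_mk 1, LocalizedModule.mk_eq] at h0
  obtain ⟨⟨_, e, he, rfl⟩, hs⟩ := h0
  refine ⟨e, he, ?_⟩
  have h1 : (e : ℤ) • Additive.ofMul c = 0 := by simpa [Submonoid.smul_def] using hs
  rw [natCast_zsmul] at h1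
  exact h1

end Denominators

/-! ### Consequences of conditions on `H_1` and `H_2` -/

section LowDegree

open scoped commutatorElement

variable {R : Subring ℚ}

/-- A homomorphism that is onto on `H_1(-; R)` is an epimorphism as far as homomorphisms to
`R`-modules are concerned. -/
theorem hom_eq_one_of_comp_eq_one {X Y : Type u} [Group X] [Group Y] (f : X →* Y)
    (hf : Function.Surjective (homologyMapWith R f 1)) {M : Type u} [AddCommGroup M]
    [Module (CoeffRing.{u} R) M] (θ : Y →* Multiplicative M) (hθ : ∀ x, θ (f x) = 1) (y : Y) :
    θ y = 1 := by
  let Θ : (Y →₀ CoeffRing.{u} R) →ₗ[CoeffRing.{u} R] M :=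
    Finsupp.linearCombination _ fun y => (θ y).toAdd
  have hΘ : Θ ∘ₗ barBoundary₂ _ Y = 0 := by
    ext ⟨g, h⟩ : 2
    simp [Θ, Finsupp.linearCombination_single]
  have hΘ' : Θ ∘ₗ Finsupp.lmapDomain _ (CoeffRing.{u} R) f = 0 := by
    ext x : 2
    simp [Θ, Finsupp.linearCombination_single, Finsupp.mapDomain_single, hθ]
  obtain ⟨z, w, h⟩ := (homologyMapWith_one_surjective_iff f).1 hf (Finsupp.single y 1)
  have h1 : Θ (Finsupp.single y 1) = 0 := by
    rw [h, map_add]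
    exact (congrArg₂ (· + ·) (LinearMap.congr_fun hΘ' z) (LinearMap.congr_fun hΘ w)).trans
      (add_zero _)
  have h2 : (θ y).toAdd = 0 := by simpa [Θ, Finsupp.linearCombination_single] using h1
  exact h2

/-- Some power of every element, with exponent a denominator of `R`, is in the image up to
commutators, if a homomorphism is onto on `H_1(-; R)`. -/
theorem exists_pow_mem_range_sup_commutator {X Y : Type u} [Group X] [Group Y] (f : X →* Y)
    (hf : Function.Surjective (homologyMapWith R f 1)) (y : Y) :
    ∃ e, IsDenominator R e ∧ y ^ e ∈ f.range ⊔ commutator Y := by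
  let N : Subgroup (Abelianization Y) := f.range.map Abelianization.of
  obtain ⟨e, he, h⟩ := exists_pow_eq_one_of_forall_hom (R := R)
    (QuotientGroup.mk' N (Abelianization.of y)) fun M _ _ θ => by
      refine hom_eq_one_of_comp_eq_one f hf
        (θ.comp ((QuotientGroup.mk' N).comp Abelianization.of)) (fun x => ?_) y
      have : QuotientGroup.mk' N (Abelianization.of (f x)) = 1 :=
        (QuotientGroup.eq_one_iff _).2 ⟨f x, ⟨x, rfl⟩, rfl⟩
      simp only [MonoidHom.comp_apply, this, map_one]
  refine ⟨e, he, ?_⟩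
  rw [← map_pow, ← map_pow] at h
  obtain ⟨z, hz, hzy⟩ := (QuotientGroup.eq_one_iff _).1 h
  have : z⁻¹ * y ^ e ∈ commutator Y := by
    rw [← Abelianization.ker_of, MonoidHom.mem_ker, map_mul, map_inv, hzy, inv_mul_cancel]
  have h3 := (f.range ⊔ commutator Y).mul_mem (Subgroup.mem_sup_left hz)
    (Subgroup.mem_sup_right this)
  rwa [mul_inv_cancel_left] at h3

/-- A part of the five term exact sequence of an extension: if `f : P → G` is onto, injective on
`H_1(-; R)` and onto on `H_2(-; R)`, then every homomorphism from its kernel to an `R`-module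
that is invariant under conjugation by `P` is trivial. -/
theorem invariant_hom_ker_eq_one {P G : Type u} [Group P] [Group G] (f : P →* G)
    (hf : Function.Surjective f) (h₁ : Function.Injective (homologyMapWith R f 1))
    (h₂ : Function.Surjective (homologyMapWith R f 2)) {M : Type u} [AddCommGroup M]
    [Module (CoeffRing.{u} R) M] (χ : f.ker →* Multiplicative M)
    (hχ : ∀ (p : P) (k : f.ker), χ ⟨p * k * p⁻¹, f.normal_ker.conj_mem k k.2 p⟩ = χ k)
    (k : f.ker) : χ k = 1 := by
  -- `t p` measures the difference between `p` and the value of a section at the image of `p`.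
  let s : G → P := Function.surjInv hf
  have hs : ∀ g, f (s g) = g := Function.surjInv_eq hf
  let t : P → M := fun p => (χ ⟨p * (s (f p))⁻¹, by simp [MonoidHom.mem_ker, hs]⟩).toAdd
  have ht : ∀ (x : f.ker) (p : P), t (x * p) = (χ x).toAdd + t p := by
    intro x p
    have hx : f (x * p) = f p := by rw [map_mul, x.2, one_mul]
    simp only [t]
    rw [← toAdd_mul, ← map_mul χ]
    refine congrArg (fun y => (χ y).toAdd) ?_
    apply Subtype.ext
    simp [hx, mul_assoc]
  let T : (P →₀ CoeffRing.{u} R) →ₗ[CoeffRing.{u} R] M := Finsupp.linearCombination _ t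
  -- The coboundary of `t` is the pull-back of a cocycle `F` on `G`.
  let F : (G × G →₀ CoeffRing.{u} R) →ₗ[CoeffRing.{u} R] M :=
    Finsupp.linearCombination _ fun g => T (barBoundary₂ _ P (Finsupp.single (s g.1, s g.2) 1))
  have hT : ∀ p q, T (barBoundary₂ _ P (Finsupp.single (p, q) 1)) = t q - t (p * q) + t p := by
    intro p q
    simp [T, Finsupp.linearCombination_single]
  have hFT : F ∘ₗ Finsupp.lmapDomain _ (CoeffRing.{u} R) (Prod.map f f) =
      T ∘ₗ barBoundary₂ _ P := by
    refine Finsupp.lhom_ext' fun pq => LinearMap.ext_ring ?_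
    obtain ⟨p, q⟩ := pq
    simp only [LinearMap.comp_apply, Finsupp.lsingle_apply, Finsupp.lmapDomain_apply,
      Finsupp.mapDomain_single, Prod.map, F, Finsupp.linearCombination_single, one_smul]
    rw [hT, hT]
    obtain ⟨x, hx⟩ : ∃ x : f.ker, p = x * s (f p) :=
      ⟨⟨p * (s (f p))⁻¹, by simp [MonoidHom.mem_ker, hs]⟩, by simp⟩
    obtain ⟨y, hy⟩ : ∃ y : f.ker, q = y * s (f q) :=
      ⟨⟨q * (s (f q))⁻¹, by simp [MonoidHom.mem_ker, hs]⟩, by simp⟩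
    have hp : t p = (χ x).toAdd + t (s (f p)) := by rw [← ht, ← hx]
    have hq : t q = (χ y).toAdd + t (s (f q)) := by rw [← ht, ← hy]
    let y' : f.ker := ⟨s (f p) * y * (s (f p))⁻¹, f.normal_ker.conj_mem y y.2 _⟩
    have hpq : t (p * q) = (χ x).toAdd + ((χ y).toAdd + t (s (f p) * s (f q))) := by
      have h' : p * q = x * (y' * (s (f p) * s (f q))) := by
        conv_lhs => rw [hx, hy]
        simp [y', mul_assoc]
      rw [h', ht, ht, hχ]
    rw [hp, hq, hpq]
    abel
  have hF : ∀ y, F (barBoundary₃ _ G y) = 0 := by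
    intro y
    obtain ⟨y, rfl⟩ : ∃ y', Finsupp.lmapDomain _ (CoeffRing.{u} R)
        (Prod.map f (Prod.map f f)) y' = y :=
      Finsupp.mapDomain_surjective (hf.prodMap (hf.prodMap hf)) y
    rw [← mapDomain_barBoundary₃]
    refine (LinearMap.congr_fun hFT _).trans ?_
    rw [LinearMap.comp_apply, barBoundary₂_barBoundary₃, map_zero]
  obtain ⟨z, hz⟩ := (homologyMapWith_one_injective_iff f).1 h₁ (Finsupp.single (k : P) 1)
    ⟨Finsupp.single (1, 1) 1, by
      simp [Finsupp.mapDomain_single, MonoidHom.mem_ker.1 k.2]⟩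
  obtain ⟨z', y, hz', hy⟩ := (homologyMapWith_two_surjective_iff f).1 h₂
    (Finsupp.lmapDomain _ (CoeffRing.{u} R) (Prod.map f f) (z - Finsupp.single (1, 1) 1)) (by
      rw [← mapDomain_barBoundary₂, map_sub, hz]
      simp [Finsupp.mapDomain_single, MonoidHom.mem_ker.1 k.2, map_sub])
  have h3 := congrArg F hy
  rw [map_add, hF, add_zero] at h3
  have h4 : T (barBoundary₂ _ P (z - Finsupp.single (1, 1) 1)) = T (barBoundary₂ _ P z') :=
    (LinearMap.congr_fun hFT _).symm.trans (h3.trans (LinearMap.congr_fun hFT _))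
  rw [hz', map_zero, map_sub, hz, map_sub, hT] at h4
  have h5 : T (Finsupp.single (k : P) 1) = (χ k).toAdd + t 1 := by
    rw [← ht, mul_one]
    simp [T, Finsupp.linearCombination_single]
  rw [h5] at h4
  have h6 : (χ k).toAdd = 0 := by simpa using h4
  exact h6

/-- If `f : P → G` is onto, injective on `H_1(-; R)` and onto on `H_2(-; R)`, then
`K / [P, K] ⊗ R = 0` for the kernel `K` of `f`. -/
theorem exists_pow_mem_commutator_ker {P G : Type u} [Group P] [Group G] (f : P →* G)
    (hf : Function.Surjective f) (h₁ : Function.Injective (homologyMapWith R f 1))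
    (h₂ : Function.Surjective (homologyMapWith R f 2)) {k : P} (hk : k ∈ f.ker) :
    ∃ e, IsDenominator R e ∧ k ^ e ∈ ⁅(⊤ : Subgroup P), f.ker⁆ := by
  let N : Subgroup f.ker := (⁅(⊤ : Subgroup P), f.ker⁆).subgroupOf f.ker
  let _ : CommGroup (f.ker ⧸ N) :=
    { (inferInstance : Group (f.ker ⧸ N)) with
      mul_comm := by
        rintro ⟨a⟩ ⟨b⟩
        refine QuotientGroup.eq.2 ?_
        have h : ⁅(b : P)⁻¹, (a : P)⁻¹⁆ ∈ ⁅(⊤ : Subgroup P), f.ker⁆ :=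
          Subgroup.commutator_mem_commutator (Subgroup.mem_top _) (f.ker.inv_mem a.2)
        rw [Subgroup.mem_subgroupOf]
        simpa [commutatorElement_def, mul_assoc] using h }
  obtain ⟨e, he, h⟩ := exists_pow_eq_one_of_forall_hom (R := R)
    (QuotientGroup.mk' N ⟨k, hk⟩) fun M _ _ θ => by
      refine invariant_hom_ker_eq_one f hf h₁ h₂ (θ.comp (QuotientGroup.mk' N)) ?_ ⟨k, hk⟩
      intro p x
      refine congrArg θ (QuotientGroup.eq.2 ?_)
      have h : ⁅p, (x : P)⁻¹⁆ ∈ ⁅(⊤ : Subgroup P), f.ker⁆ :=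
        Subgroup.commutator_mem_commutator (Subgroup.mem_top _) (f.ker.inv_mem x.2)
      rw [Subgroup.mem_subgroupOf]
      simpa [commutatorElement_def, mul_assoc] using h
  refine ⟨e, he, ?_⟩
  rw [← map_pow] at h
  simpa [N, Subgroup.mem_subgroupOf] using (QuotientGroup.eq_one_iff _).1 h

end LowDegree

/-! ### `R`-nullhomologous systems and orthogonality -/

section Systems

open Monoid.Coprod

variable {R : Subring ℚ}

universe v w

namespace NullSystem

/-- The system over `B` obtained by applying `f : A → B` to the constants of a system over `A`. -/
abbrev map {A : Type v} {B : Type w} [Group A] [Group B] (f : A →* B) (S : NullSystem R A) :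
    NullSystem R B where
  n := S.n
  e := S.e
  e_mem := S.e_mem
  w i := Monoid.Coprod.map f (MonoidHom.id _) (S.w i)
  null i := by
    have h : (Monoid.Coprod.snd : B ∗ FreeGroup (Fin S.n) →* _).comp
        (Monoid.Coprod.map f (MonoidHom.id _)) = Monoid.Coprod.snd :=
      Monoid.Coprod.hom_ext (by ext; simp) (by ext; simp)
    exact (congrArg Abelianization.of (DFunLike.congr_fun h (S.w i))).trans (S.null i)

/-- The value `w(a)` of an element `w(x_1, …, x_n)` of `A * F` in a group `B` under `A`. -/
abbrev value {A : Type v} {B : Type w} [Group A] [Group B] {n : ℕ} (f : A →* B) (b : Fin n → B) :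
    A ∗ FreeGroup (Fin n) →* B :=
  Monoid.Coprod.lift f (FreeGroup.lift b)

/-- `b` solves the system over `A` in a group `B` under `A`. -/
def IsSolutionIn {A : Type v} {B : Type w} [Group A] [Group B] (S : NullSystem R A) (f : A →* B)
    (b : Fin S.n → B) : Prop :=
  ∀ i, b i ^ S.e = value f b (S.w i)

theorem comp_value {A B C : Type*} [Group A] [Group B] [Group C] {n : ℕ} (f : A →* B)
    (g : B →* C) (b : Fin n → B) : g.comp (value f b) = value (g.comp f) (g ∘ b) :=
  Monoid.Coprod.hom_ext (by ext; simp) (by ext; simp)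

theorem map_value {A B C : Type*} [Group A] [Group B] [Group C] {n : ℕ} (f : A →* B)
    (g : B →* C) (b : Fin n → B) (x : A ∗ FreeGroup (Fin n)) :
    g (value f b x) = value (g.comp f) (g ∘ b) x :=
  DFunLike.congr_fun (comp_value f g b) x

theorem isSolutionIn_map_iff {A B C : Type*} [Group A] [Group B] [Group C] {f : A →* B}
    {g : B →* C} {S : NullSystem R A} {c : Fin S.n → C} :
    (S.map f).IsSolutionIn g c ↔ S.IsSolutionIn (g.comp f) c := by
  refine forall_congr' fun i => ?_
  have h : (value g c).comp (Monoid.Coprod.map f (MonoidHom.id _)) = value (g.comp f) c :=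
    Monoid.Coprod.hom_ext (by ext; simp) (by ext; simp)
  rw [← h]
  rfl

theorem isSolution_map_iff {A : Type v} {B : Type w} [Group A] [Group B] {f : A →* B}
    {S : NullSystem R A} {b : Fin S.n → B} : (S.map f).IsSolution b ↔ S.IsSolutionIn f b :=
  isSolutionIn_map_iff (g := MonoidHom.id B)

theorem IsSolutionIn.comp {A B C : Type*} [Group A] [Group B] [Group C] {f : A →* B}
    {S : NullSystem R A} {b : Fin S.n → B} (hb : S.IsSolutionIn f b) (g : B →* C) :
    S.IsSolutionIn (g.comp f) (g ∘ b) := by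
  intro i
  rw [← map_value, ← hb, Function.comp_apply, map_pow]

theorem IsSolution.isSolutionIn {A B : Type*} [Group A] [Group B] {S : NullSystem R A}
    {a : Fin S.n → A} (ha : S.IsSolution a) (g : A →* B) : S.IsSolutionIn g (g ∘ a) :=
  IsSolutionIn.comp (f := MonoidHom.id A) ha g

/-- Changing the unknowns by central elements does not change the value of a word that is
trivial in `F / [F, F]`. -/
theorem value_mul_central {A B : Type*} [Group A] [Group B] (f : A →* B) (S : NullSystem R A)
    (b : Fin S.n → B) (z : Fin S.n → Subgroup.center B) (i : Fin S.n) :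
    value f (fun j => b j * z j) (S.w i) = value f b (S.w i) := by
  let ζ : FreeGroup (Fin S.n) →* Subgroup.center B := FreeGroup.lift z
  have key : ∀ x : A ∗ FreeGroup (Fin S.n),
      value f (fun j => b j * z j) x = value f b x * ζ (Monoid.Coprod.snd x) := by
    have hc : ∀ (x : Subgroup.center B) (y : B), y * x = x * y :=
      fun x y => Subgroup.mem_center_iff.1 x.2 y
    have hmul : ∀ x y : A ∗ FreeGroup (Fin S.n),
        value f (fun j => b j * z j) x = value f b x * ζ (Monoid.Coprod.snd x) →
        value f (fun j => b j * z j) y = value f b y * ζ (Monoid.Coprod.snd y) →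
        value f (fun j => b j * z j) (x * y) =
          value f b (x * y) * ζ (Monoid.Coprod.snd (x * y)) := by
      intro x y hx hy
      rw [map_mul, map_mul, map_mul, map_mul, hx, hy, Subgroup.coe_mul, mul_assoc, mul_assoc,
        ← mul_assoc _ (value f b y), ← hc _ (value f b y), mul_assoc]
    intro x
    induction x using Monoid.Coprod.induction_on with
    | inl a => simp
    | inr a =>
      induction a using FreeGroup.induction_on with
      | C1 => simp
      | of j => simp [ζ]
      | inv_of j _ =>
        have h := hc (z j)⁻¹ (b j)⁻¹
        simpa [ζ] using h.symm
      | mul x y hx hy =>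
        rw [map_mul]
        exact hmul _ _ hx hy
    | mul x y hx hy => exact hmul x y hx hy
  have h1 : ζ (Monoid.Coprod.snd (S.w i)) = 1 := by
    let _ : CommGroup (Subgroup.center B) :=
      { (inferInstance : Group (Subgroup.center B)) with
        mul_comm := fun x y => Subtype.ext (Subgroup.mem_center_iff.1 y.2 x) }
    have h := Abelianization.lift_apply_of (A := Subgroup.center B) ζ (Monoid.Coprod.snd (S.w i))
    rw [S.null, map_one] at h
    exact h.symm
  rw [key, h1, Subgroup.coe_one, mul_one]

end NullSystem

/-- A homomorphism `p : E → B` is relatively `R`-closed if solutions in `B` of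
`R`-nullhomologous systems over `E` lift uniquely to solutions in `E`. -/
def IsRelativelyClosed (R : Subring ℚ) {E B : Type*} [Group E] [Group B] (p : E →* B) : Prop :=
  ∀ (S : NullSystem R E) (b : Fin S.n → B), S.IsSolutionIn p b →
    ∃! a : Fin S.n → E, S.IsSolution a ∧ p ∘ a = b

theorem IsRClosed.isRelativelyClosed {A : Type u} [Group A] (hA : IsRClosed R A) :
    IsRelativelyClosed R (1 : A →* PUnit.{u + 1}) := by
  intro S b _
  obtain ⟨a, ha, hu⟩ := hA S
  exact ⟨a, ⟨ha, funext fun _ => rfl⟩, fun a' h => hu a' h.1⟩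

/-- Central extensions whose kernel is uniquely divisible by the denominators of `R` are
relatively `R`-closed. -/
theorem isRelativelyClosed_of_central {E B : Type*} [Group E] [Group B] (p : E →* B)
    (hp : Function.Surjective p) (hc : p.ker ≤ Subgroup.center E)
    (hd : ∀ e, IsDenominator R e → Function.Bijective fun x : p.ker => x ^ e) :
    IsRelativelyClosed R p := by
  intro S b hb
  have hS := S.e_mem
  -- Any other choice of lifts differs from `y` by central elements.
  have hz : ∀ (y : Fin S.n → E) (m : Fin S.n → p.ker) (i : Fin S.n),
      Monoid.Coprod.lift (MonoidHom.id E) (FreeGroup.lift fun j => y j * m j) (S.w i) =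
        Monoid.Coprod.lift (MonoidHom.id E) (FreeGroup.lift y) (S.w i) := fun y m i =>
    NullSystem.value_mul_central (MonoidHom.id E) S y (fun j => ⟨m j, hc (m j).2⟩) i
  have hpow : ∀ (y : E) (m : p.ker) (e : ℕ), (y * m) ^ e = y ^ e * (m ^ e : p.ker) := by
    intro y m e
    have hcomm : Commute y m := Subgroup.mem_center_iff.1 (hc m.2) y
    rw [hcomm.mul_pow, Subgroup.coe_pow]
  choose y hy using fun i => hp (b i)
  have hy' : p ∘ y = b := funext hy
  have hm : ∀ i, ∃ m : p.ker, m ^ S.e =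
      (⟨(y i ^ S.e)⁻¹ * Monoid.Coprod.lift (MonoidHom.id E) (FreeGroup.lift y) (S.w i), by
        have h1 := hb i
        have h2 := NullSystem.map_value (MonoidHom.id E) p y (S.w i)
        rw [MonoidHom.mem_ker, map_mul, map_inv, map_pow, hy, h1]
        rw [hy'] at h2
        exact (congrArg (_ * ·) h2).trans (inv_mul_cancel _)⟩ : p.ker) := fun i =>
    (hd S.e hS).2 _
  choose m hm using hm
  refine ⟨fun i => y i * m i, ⟨fun i => ?_, funext fun i => ?_⟩, ?_⟩
  · rw [hz, hpow, hm, mul_inv_cancel_left]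
  · simp [hy, MonoidHom.mem_ker.1 (m i).2]
  · rintro a ⟨ha, hab⟩
    let m' : Fin S.n → p.ker := fun i => ⟨(y i)⁻¹ * a i, by
      rw [MonoidHom.mem_ker, map_mul, map_inv, hy, ← hab]
      exact inv_mul_cancel _⟩
    have ham : ∀ i, a i = y i * m' i := fun i => by simp [m']
    funext i
    have h1 := ha i
    rw [show a = fun i => y i * m' i from funext ham, hz, hpow] at h1
    have h2 : m' i = m i := by
      refine (hd S.e hS).1 ?_
      refine Subtype.ext ?_
      change ((m' i ^ S.e : p.ker) : E) = (m i ^ S.e : p.ker)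
      rw [hm]
      exact eq_inv_mul_iff_mul_eq.2 h1
    rw [ham, h2]

/-- The homomorphisms `α : X → Y` with the unique lifting property with respect to all
relatively `R`-closed homomorphisms. -/
def LeftOrthogonal (R : Subring ℚ) {X Y : Type u} [Group X] [Group Y] (α : X →* Y) : Prop :=
  ∀ (E B : Type u) [Group E] [Group B] (p : E →* B), IsRelativelyClosed R p →
    ∀ (φ : X →* E) (ψ : Y →* B), ψ.comp α = p.comp φ →
      ∃! χ : Y →* E, χ.comp α = φ ∧ p.comp χ = ψ

theorem LeftOrthogonal.existsUnique_extension {X Y : Type u} [Group X] [Group Y] {α : X →* Y}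
    (hα : LeftOrthogonal R α) {A : Type u} [Group A] (hA : IsRClosed R A) (φ : X →* A) :
    ∃! χ : Y →* A, χ.comp α = φ := by
  obtain ⟨χ, hχ, hu⟩ := hα A PUnit 1 hA.isRelativelyClosed φ 1 (by ext)
  exact ⟨χ, hχ.1, fun χ' h => hu χ' ⟨h, by ext⟩⟩

namespace NullSystem

/-- The group obtained from `A` by adjoining a solution of a system. -/
abbrev Adjoin {A : Type v} [Group A] (S : NullSystem R A) : Type v :=
  (A ∗ FreeGroup (Fin S.n)) ⧸ Subgroup.normalClosure
    (Set.range fun i => (S.w i)⁻¹ * inr (FreeGroup.of i) ^ S.e)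

/-- The canonical homomorphism to the group in which a solution is adjoined. -/
def toAdjoin {A : Type v} [Group A] (S : NullSystem R A) : A →* S.Adjoin :=
  (QuotientGroup.mk' _).comp inl

/-- The adjoined solution. -/
def root {A : Type v} [Group A] (S : NullSystem R A) (i : Fin S.n) : S.Adjoin :=
  QuotientGroup.mk' _ (inr (FreeGroup.of i))

theorem value_toAdjoin_root {A : Type v} [Group A] (S : NullSystem R A) :
    value S.toAdjoin S.root = QuotientGroup.mk' _ :=
  Monoid.Coprod.hom_ext (by ext; simp [toAdjoin]) (by ext; simp [root])

theorem isSolutionIn_root {A : Type v} [Group A] (S : NullSystem R A) :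
    S.IsSolutionIn S.toAdjoin S.root := by
  intro i
  rw [value_toAdjoin_root]
  have h : (QuotientGroup.mk' _ (S.w i) : S.Adjoin) =
      QuotientGroup.mk' _ (inr (FreeGroup.of i) ^ S.e) :=
    QuotientGroup.eq.2 (Subgroup.subset_normalClosure ⟨i, rfl⟩)
  rw [h, map_pow, root]

/-- The homomorphism from `S.Adjoin` defined by a solution. -/
def adjoinLift {A : Type v} {B : Type w} [Group A] [Group B] (S : NullSystem R A) (f : A →* B)
    (b : Fin S.n → B) (hb : S.IsSolutionIn f b) : S.Adjoin →* B :=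
  QuotientGroup.lift _ (value f b) <| by
    refine Subgroup.normalClosure_le_normal ?_
    rintro _ ⟨i, rfl⟩
    rw [SetLike.mem_coe, MonoidHom.mem_ker, map_mul, map_inv, map_pow, lift_apply_inr,
      FreeGroup.lift_apply_of, hb, inv_mul_cancel]

@[simp]
theorem adjoinLift_comp_toAdjoin {A : Type v} {B : Type w} [Group A] [Group B]
    (S : NullSystem R A) (f : A →* B) (b : Fin S.n → B) (hb : S.IsSolutionIn f b) :
    (S.adjoinLift f b hb).comp S.toAdjoin = f := by
  ext a
  simp [adjoinLift, toAdjoin]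

@[simp]
theorem adjoinLift_root {A : Type v} {B : Type w} [Group A] [Group B]
    (S : NullSystem R A) (f : A →* B) (b : Fin S.n → B) (hb : S.IsSolutionIn f b)
    (i : Fin S.n) : S.adjoinLift f b hb (S.root i) = b i := by
  simp [adjoinLift, root]

theorem adjoin_hom_ext {A : Type v} {B : Type w} [Group A] [Group B] (S : NullSystem R A)
    {f g : S.Adjoin →* B} (h : f.comp S.toAdjoin = g.comp S.toAdjoin)
    (hr : f ∘ S.root = g ∘ S.root) : f = g := by
  refine QuotientGroup.monoidHom_ext _ (Monoid.Coprod.hom_ext h ?_)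
  ext i
  exact congrFun hr i

theorem leftOrthogonal_toAdjoin {A : Type u} [Group A] (S : NullSystem R A) :
    LeftOrthogonal R S.toAdjoin := by
  intro E B _ _ p hp φ ψ h
  have hb := S.isSolutionIn_root.comp ψ
  rw [h, ← isSolutionIn_map_iff] at hb
  obtain ⟨a, ⟨ha, hab⟩, hu⟩ := hp (S.map φ) (ψ ∘ S.root) hb
  rw [isSolution_map_iff] at ha
  refine ⟨S.adjoinLift φ a ha, ⟨by simp, ?_⟩, ?_⟩
  · refine S.adjoin_hom_ext ?_ ?_
    · rw [MonoidHom.comp_assoc, adjoinLift_comp_toAdjoin, h]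
    · rw [← hab]
      funext i
      simp
  · rintro χ ⟨h1, h2⟩
    refine S.adjoin_hom_ext (by rw [h1, adjoinLift_comp_toAdjoin]) ?_
    have h3 := S.isSolutionIn_root.comp χ
    rw [h1, ← isSolution_map_iff] at h3
    rw [hu (χ ∘ S.root) ⟨h3, by rw [← h2]; rfl⟩]
    funext i
    simp

/-- The group obtained from `A` by identifying two tuples. -/
abbrev Identify {A : Type v} [Group A] {n : ℕ} (a b : Fin n → A) : Type v :=
  A ⧸ Subgroup.normalClosure (Set.range fun i => (a i)⁻¹ * b i)

theorem leftOrthogonal_identify {A : Type u} [Group A] (S : NullSystem R A) {a b : Fin S.n → A}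
    (ha : S.IsSolution a) (hb : S.IsSolution b) :
    LeftOrthogonal R (QuotientGroup.mk' _ : A →* Identify a b) := by
  intro E B _ _ p hp φ ψ h
  have hab : p ∘ φ ∘ a = p ∘ φ ∘ b := by
    funext i
    change p.comp φ (a i) = p.comp φ (b i)
    rw [← h]
    exact congrArg ψ (QuotientGroup.eq.2 (Subgroup.subset_normalClosure ⟨i, rfl⟩))
  have h1 : φ ∘ a = φ ∘ b :=
    (hp (S.map φ) (p ∘ φ ∘ a) (isSolutionIn_map_iff.2 ((ha.isSolutionIn φ).comp p))).unique
      ⟨isSolution_map_iff.2 (ha.isSolutionIn φ), rfl⟩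
      ⟨isSolution_map_iff.2 (hb.isSolutionIn φ), hab.symm⟩
  have h2 : Subgroup.normalClosure (Set.range fun i => (a i)⁻¹ * b i) ≤ φ.ker := by
    refine Subgroup.normalClosure_le_normal ?_
    rintro _ ⟨i, rfl⟩
    have h3 : φ (a i) = φ (b i) := congrFun h1 i
    rw [SetLike.mem_coe, MonoidHom.mem_ker, map_mul, map_inv, h3, inv_mul_cancel]
  refine ⟨QuotientGroup.lift _ φ h2, ⟨by ext; simp, ?_⟩, ?_⟩
  · refine QuotientGroup.monoidHom_ext _ ?_
    rw [h]
    ext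
    simp
  · rintro χ ⟨h3, -⟩
    refine QuotientGroup.monoidHom_ext _ ?_
    rw [h3]
    ext
    simp

end NullSystem

end Systems

/-! ### Central extensions and the homology of orthogonal homomorphisms -/

/-- The central extension of a group `Y` by a module `M` (with trivial action) defined by a
2-cocycle `c`, as the set `M × Y` with the multiplication twisted by `c`. -/
@[ext]
structure CocycleExtension {Y M : Type u} [Group Y] [AddCommGroup M] (c : Y → Y → M)
    (hc : ∀ g h j, c h j - c (g * h) j + c g (h * j) - c g h = 0) where
  /-- The component in the kernel. -/
  fiber : M
  /-- The component in the quotient. -/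
  base : Y

namespace CocycleExtension

variable {Y M : Type u} [Group Y] [AddCommGroup M] {c : Y → Y → M}
  {hc : ∀ g h j, c h j - c (g * h) j + c g (h * j) - c g h = 0}

theorem cocycle_one_left (hc : ∀ g h j, c h j - c (g * h) j + c g (h * j) - c g h = 0) (g : Y) :
    c 1 g = c 1 1 := by
  have := hc 1 1 g
  simp only [mul_one, one_mul, sub_self, zero_add] at this
  exact sub_eq_zero.1 this

theorem cocycle_one_right (hc : ∀ g h j, c h j - c (g * h) j + c g (h * j) - c g h = 0) (g : Y) :
    c g 1 = c 1 1 := by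
  have := hc g 1 1
  simp only [mul_one, sub_add_cancel] at this
  exact (sub_eq_zero.1 this).symm

instance : Mul (CocycleExtension c hc) :=
  ⟨fun x y => ⟨x.fiber + y.fiber + c x.base y.base, x.base * y.base⟩⟩

instance : One (CocycleExtension c hc) := ⟨⟨-c 1 1, 1⟩⟩

instance : Inv (CocycleExtension c hc) :=
  ⟨fun x => ⟨-x.fiber - c x.base⁻¹ x.base - c 1 1, x.base⁻¹⟩⟩

@[simp] theorem mul_fiber (x y : CocycleExtension c hc) :
    (x * y).fiber = x.fiber + y.fiber + c x.base y.base := rfl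
@[simp] theorem mul_base (x y : CocycleExtension c hc) : (x * y).base = x.base * y.base := rfl
@[simp] theorem one_fiber : (1 : CocycleExtension c hc).fiber = -c 1 1 := rfl
@[simp] theorem one_base : (1 : CocycleExtension c hc).base = 1 := rfl
@[simp] theorem inv_fiber (x : CocycleExtension c hc) :
    x⁻¹.fiber = -x.fiber - c x.base⁻¹ x.base - c 1 1 := rfl
@[simp] theorem inv_base (x : CocycleExtension c hc) : x⁻¹.base = x.base⁻¹ := rfl

instance : Group (CocycleExtension c hc) :=
  Group.ofLeftAxioms
    (fun x y z => by
      refine CocycleExtension.ext ?_ (mul_assoc _ _ _)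
      have h := hc x.base y.base z.base
      simp only [mul_fiber, mul_base]
      rw [← sub_eq_zero, ← neg_eq_zero, ← h]
      abel)
    (fun x => CocycleExtension.ext (by simp [cocycle_one_left hc]) (one_mul _))
    (fun x => CocycleExtension.ext (by
      simp only [mul_fiber, inv_fiber, inv_base, one_fiber]
      abel) (inv_mul_cancel _))

/-- The projection of the extension. -/
@[simps]
def proj (c : Y → Y → M) (hc : ∀ g h j, c h j - c (g * h) j + c g (h * j) - c g h = 0) :
    CocycleExtension c hc →* Y where
  toFun x := x.base
  map_one' := rfl
  map_mul' _ _ := rfl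

theorem proj_surjective : Function.Surjective (proj c hc) := fun y => ⟨⟨0, y⟩, rfl⟩

theorem ker_proj_le_center : (proj c hc).ker ≤ Subgroup.center (CocycleExtension c hc) := by
  intro x hx
  have hx : x.base = 1 := hx
  refine Subgroup.mem_center_iff.2 fun y => CocycleExtension.ext ?_ ?_
  · simp [hx, cocycle_one_left hc, cocycle_one_right hc, add_comm]
  · simp [hx]

/-- The inclusion of the module into the extension. -/
def incl (c : Y → Y → M) (hc : ∀ g h j, c h j - c (g * h) j + c g (h * j) - c g h = 0) :
    Multiplicative M →* (proj c hc).ker where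
  toFun m := ⟨⟨m.toAdd - c 1 1, 1⟩, rfl⟩
  map_one' := Subtype.ext (CocycleExtension.ext (by simp) rfl)
  map_mul' m n := Subtype.ext (CocycleExtension.ext (by
    simp only [toAdd_mul, Subgroup.coe_mul, mul_fiber]
    abel) (by simp))

theorem incl_bijective : Function.Bijective (incl c hc) := by
  constructor
  · intro m n h
    have h' : m.toAdd - c 1 1 = n.toAdd - c 1 1 :=
      congrArg (fun x : (proj c hc).ker => x.1.fiber) h
    exact Multiplicative.toAdd.injective (sub_left_injective h')
  · rintro ⟨x, hx⟩
    refine ⟨Multiplicative.ofAdd (x.fiber + c 1 1), Subtype.ext (CocycleExtension.ext ?_ ?_)⟩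
    · simp [incl]
    · exact (MonoidHom.mem_ker.1 hx).symm

end CocycleExtension

section Orthogonal

variable {R : Subring ℚ}

theorem IsDenominator.bijective_pow {M : Type*} [AddCommGroup M] [Module (CoeffRing.{u} R) M]
    {e : ℕ} (he : IsDenominator R e) :
    Function.Bijective fun m : Multiplicative M => m ^ e := by
  obtain ⟨v, hv⟩ := he.isUnit.{u}
  have h : ∀ m : M, e • m = v • m := fun m => by
    rw [← Nat.cast_smul_eq_nsmul (CoeffRing.{u} R), ← hv, Units.smul_def]
  have hb : Function.Bijective fun m : M => e • m := by
    simp only [h]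
    exact MulAction.bijective v
  exact hb

theorem isRelativelyClosed_one_module (M : Type u) [AddCommGroup M]
    [Module (CoeffRing.{u} R) M] :
    IsRelativelyClosed R (1 : Multiplicative M →* PUnit.{u + 1}) := by
  refine isRelativelyClosed_of_central _ (fun _ => ⟨1, rfl⟩) ?_ fun e he => ?_
  · intro x _
    exact Subgroup.mem_center_iff.2 fun y => mul_comm _ _
  · have h := he.bijective_pow (M := M)
    constructor
    · intro x y hxy
      exact Subtype.ext (h.1 (congrArg Subtype.val hxy))
    · rintro ⟨y, hy⟩
      obtain ⟨x, hx⟩ := h.2 y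
      exact ⟨⟨x, rfl⟩, Subtype.ext hx⟩

theorem isRelativelyClosed_proj {Y M : Type u} [Group Y] [AddCommGroup M]
    [Module (CoeffRing.{u} R) M] (c : Y → Y → M)
    (hc : ∀ g h j, c h j - c (g * h) j + c g (h * j) - c g h = 0) :
    IsRelativelyClosed R (CocycleExtension.proj c hc) := by
  refine isRelativelyClosed_of_central _ CocycleExtension.proj_surjective
    CocycleExtension.ker_proj_le_center fun e he => ?_
  have h := he.bijective_pow (M := M)
  have hi := CocycleExtension.incl_bijective (c := c) (hc := hc)
  rw [← Function.Bijective.of_comp_iff _ hi]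
  have : (fun x : (CocycleExtension.proj c hc).ker => x ^ e) ∘ CocycleExtension.incl c hc =
      CocycleExtension.incl c hc ∘ fun m => m ^ e := by
    funext m
    simp
  rw [this]
  exact hi.comp h

theorem LeftOrthogonal.existsUnique_extension_module {X Y : Type u} [Group X] [Group Y]
    {α : X →* Y} (hα : LeftOrthogonal R α) {M : Type u} [AddCommGroup M]
    [Module (CoeffRing.{u} R) M] (φ : X →* Multiplicative M) :
    ∃! χ : Y →* Multiplicative M, χ.comp α = φ := by
  obtain ⟨χ, hχ, hu⟩ := hα _ PUnit 1 (isRelativelyClosed_one_module M) φ 1 (by ext)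
  exact ⟨χ, hχ.1, fun χ' h => hu χ' ⟨h, by ext⟩⟩

/-- The canonical homomorphism from a group to its first homology. -/
def toHomologyOne (R : Subring ℚ) (G : Type u) [Group G] :
    G →* Multiplicative (homologyWith R G 1) where
  toFun g := Multiplicative.ofAdd (homologyClass₁ R G (Finsupp.single g 1))
  map_one' := by
    rw [ofAdd_eq_one, homologyClass₁_eq_zero_iff]
    exact ⟨Finsupp.single (1, 1) 1, by simp⟩
  map_mul' g h := by
    rw [← ofAdd_add, ← map_add]
    refine congrArg _ (eq_of_sub_eq_zero ?_)
    rw [← map_sub, homologyClass₁_eq_zero_iff]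
    refine ⟨-Finsupp.single (g, h) 1, ?_⟩
    rw [map_neg, barBoundary₂_single]
    abel

theorem LeftOrthogonal.homologyMapWith_one_injective {X Y : Type u} [Group X] [Group Y]
    {α : X →* Y} (hα : LeftOrthogonal R α) : Function.Injective (homologyMapWith R α 1) := by
  rw [homologyMapWith_one_injective_iff]
  rintro x ⟨y, hy⟩
  obtain ⟨χ, hχ, -⟩ := hα.existsUnique_extension_module (toHomologyOne R X)
  -- An extension of `X → H_1(X; R)` to `Y` defines a left inverse of `H_1(α; R)`.
  let Θ : (Y →₀ CoeffRing.{u} R) →ₗ[CoeffRing.{u} R] homologyWith R X 1 :=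
    Finsupp.linearCombination _ fun y => (χ y).toAdd
  have h1 : Θ ∘ₗ barBoundary₂ _ Y = 0 := by
    ext ⟨g, h⟩ : 2
    simp [Θ, Finsupp.linearCombination_single]
  have h2 : Θ ∘ₗ Finsupp.lmapDomain _ (CoeffRing.{u} R) α = homologyClass₁ R X := by
    ext x : 2
    have h3 : χ (α x) = toHomologyOne R X x := DFunLike.congr_fun hχ x
    simp [Θ, Finsupp.linearCombination_single, Finsupp.mapDomain_single, h3, toHomologyOne]
  rw [← homologyClass₁_eq_zero_iff, ← h2, LinearMap.comp_apply, ← hy]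
  exact LinearMap.congr_fun h1 y

theorem LeftOrthogonal.homologyMapWith_one_surjective {X Y : Type u} [Group X] [Group Y]
    {α : X →* Y} (hα : LeftOrthogonal R α) : Function.Surjective (homologyMapWith R α 1) := by
  let N : Submodule (CoeffRing.{u} R) (homologyWith R Y 1) :=
    LinearMap.range (homologyMapWith R α 1).hom
  let q : Multiplicative (homologyWith R Y 1) →* Multiplicative (homologyWith R Y 1 ⧸ N) :=
    AddMonoidHom.toMultiplicative N.mkQ.toAddMonoidHom
  -- Both `Y → H_1(Y; R) / N` and the trivial map extend the trivial map on `X`.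
  have h : q.comp (toHomologyOne R Y) = 1 := by
    refine (hα.existsUnique_extension_module 1).unique ?_ (by ext; rfl)
    ext x
    refine (Submodule.Quotient.mk_eq_zero N).2 ⟨homologyClass₁ R X (Finsupp.single x 1), ?_⟩
    refine (homologyMapWith_homologyClass₁ _ _).trans ?_
    simp [Finsupp.mapDomain_single, toHomologyOne]
  have h2 : N.mkQ ∘ₗ homologyClass₁ R Y = 0 := by
    refine Finsupp.lhom_ext' fun y => LinearMap.ext_ring ?_
    exact DFunLike.congr_fun h y
  intro x
  obtain ⟨x, rfl⟩ := homologyClass₁_surjective x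
  exact (Submodule.Quotient.mk_eq_zero N).1 (LinearMap.congr_fun h2 x)

/-- A linear map to an injective module that vanishes on the kernel of `d` extends along `d`. -/
theorem exists_comp_eq_of_ker_le {k : Type u} [CommRing k] {A B M : Type u} [AddCommGroup A]
    [AddCommGroup B] [AddCommGroup M] [Module k A] [Module k B] [Module k M]
    [Module.Injective k M] (d : A →ₗ[k] B) (g : A →ₗ[k] M)
    (h : LinearMap.ker d ≤ LinearMap.ker g) : ∃ T : B →ₗ[k] M, T ∘ₗ d = g := by
  obtain ⟨T, hT⟩ := Module.Injective.out ((LinearMap.ker d).liftQ d le_rfl)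
    (LinearMap.ker_eq_bot.1 (Submodule.ker_liftQ_eq_bot _ _ _ le_rfl))
    ((LinearMap.ker d).liftQ g h)
  exact ⟨T, LinearMap.ext fun x => hT (Submodule.Quotient.mk x)⟩

theorem exists_injective_module (k : Type u) [CommRing k] (Q : Type u) [AddCommGroup Q]
    [Module k Q] : ∃ (M : Type u) (_ : AddCommGroup M) (_ : Module k M)
      (_ : Module.Injective k M) (ι : Q →ₗ[k] M), Function.Injective ι := by
  let J := Injective.under (ModuleCat.of k Q)
  refine ⟨J, inferInstance, inferInstance, ?_, (Injective.ι (ModuleCat.of k Q)).hom, ?_⟩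
  · have : Injective (ModuleCat.of k J) := inferInstanceAs (Injective J)
    exact Module.injective_module_of_injective_object k J
  · exact (ModuleCat.mono_iff_injective (Injective.ι (ModuleCat.of k Q))).1 inferInstance

/-- Unique lifting in central extensions implies surjectivity on `H_2(-; R)`. Embed the cokernel
of the map on `H_2` into an injective module. The resulting cocycle on `Y` becomes a coboundary
on `X`, so the central extension it defines splits over `X`, hence over `Y`. -/
theorem LeftOrthogonal.homologyMapWith_two_surjective {X Y : Type u} [Group X] [Group Y]
    {α : X →* Y} (hα : LeftOrthogonal R α) : Function.Surjective (homologyMapWith R α 2) := by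
  rw [homologyMapWith_two_surjective_iff]
  let C : (X × X →₀ CoeffRing.{u} R) →ₗ[CoeffRing.{u} R] (Y × Y →₀ CoeffRing.{u} R) :=
    Finsupp.lmapDomain _ (CoeffRing.{u} R) (Prod.map α α)
  let N : Submodule (CoeffRing.{u} R) (Y × Y →₀ CoeffRing.{u} R) :=
    (LinearMap.ker (barBoundary₂ (CoeffRing.{u} R) X)).map C ⊔
      LinearMap.range (barBoundary₃ (CoeffRing.{u} R) Y)
  obtain ⟨M, _, _, _, ι, hι⟩ := exists_injective_module (CoeffRing.{u} R)
    ((Y × Y →₀ CoeffRing.{u} R) ⧸ N)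
  let F := ι ∘ₗ N.mkQ
  have hF : ∀ x, F x = 0 ↔ x ∈ N := fun x => by
    rw [← Submodule.Quotient.mk_eq_zero N, ← map_eq_zero_iff ι hι]
    rfl
  let c : Y → Y → M := fun g h => F (Finsupp.single (g, h) 1)
  have hc : ∀ g h j, c h j - c (g * h) j + c g (h * j) - c g h = 0 := fun g h j => by
    have h1 := (hF (barBoundary₃ _ Y (Finsupp.single (g, h, j) 1))).2
      (Submodule.mem_sup_right ⟨_, rfl⟩)
    simpa [c] using h1
  obtain ⟨T, hT⟩ := exists_comp_eq_of_ker_le (barBoundary₂ (CoeffRing.{u} R) X) (F ∘ₗ C)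
    fun x hx => (hF _).2 (Submodule.mem_sup_left ⟨x, hx, rfl⟩)
  have hT' : ∀ x y, T (Finsupp.single y 1) - T (Finsupp.single (x * y) 1) +
      T (Finsupp.single x 1) = c (α x) (α y) := fun x y => by
    have h1 := LinearMap.congr_fun hT (Finsupp.single (x, y) 1)
    simpa [C, c, Finsupp.mapDomain_single] using h1
  let φ : X →* CocycleExtension c hc := MonoidHom.mk'
    (fun x => ⟨-T (Finsupp.single x 1), α x⟩) fun x y => CocycleExtension.ext (by
      simp only [CocycleExtension.mul_fiber, ← hT']
      abel) (map_mul α x y)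
  obtain ⟨χ, ⟨-, hχ⟩, -⟩ := hα _ _ _ (isRelativelyClosed_proj (R := R) c hc) φ (MonoidHom.id Y)
    (by ext; rfl)
  have hbase : ∀ y, (χ y).base = y := fun y => DFunLike.congr_fun hχ y
  let U : (Y →₀ CoeffRing.{u} R) →ₗ[CoeffRing.{u} R] M :=
    Finsupp.linearCombination _ fun y => (χ y).fiber
  have hU : F = -(U ∘ₗ barBoundary₂ _ Y) := by
    refine Finsupp.lhom_ext' fun gh => LinearMap.ext_ring ?_
    obtain ⟨g, h⟩ := gh
    have h1 : (χ (g * h)).fiber = (χ g).fiber + (χ h).fiber + c g h := by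
      rw [map_mul, CocycleExtension.mul_fiber, hbase, hbase]
    change c g h = _
    simp only [LinearMap.comp_apply, LinearMap.neg_apply, Finsupp.lsingle_apply,
      barBoundary₂_single, map_add, map_sub, U, Finsupp.linearCombination_single, one_smul, h1]
    abel
  intro x hx
  have hxN : x ∈ N := by
    rw [← hF, hU, LinearMap.neg_apply, LinearMap.comp_apply, hx, map_zero, neg_zero]
  obtain ⟨_, ⟨z, hz, rfl⟩, _, ⟨y, rfl⟩, h⟩ := Submodule.mem_sup.1 hxN
  exact ⟨z, y, hz, h.symm⟩

theorem LeftOrthogonal.twoConnected {X Y : GrpCat.{u}} {α : X ⟶ Y}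
    (hα : LeftOrthogonal R α.hom) : TwoConnected R α :=
  ⟨⟨hα.homologyMapWith_one_injective, hα.homologyMapWith_one_surjective⟩,
    hα.homologyMapWith_two_surjective⟩

end Orthogonal

/-! ### Finite generation of kernels -/

section Generation

theorem Monoid.Coprod.group_fg {A B : Type*} [Group A] [Group B] (hA : Group.FG A)
    (hB : Group.FG B) : Group.FG (Monoid.Coprod A B) := by
  have h₁ : (Monoid.Coprod.inl : A →* Monoid.Coprod A B).range.FG :=
    (Group.fg_iff_subgroup_fg _).1 (Group.fg_range _)
  have h₂ : (Monoid.Coprod.inr : B →* Monoid.Coprod A B).range.FG :=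
    (Group.fg_iff_subgroup_fg _).1 (Group.fg_range _)
  rw [Group.fg_def, ← Monoid.Coprod.range_inl_sup_range_inr]
  exact h₁.sup h₂

/-- The kernel of a homomorphism from a finitely generated group onto a finitely presented group
is finitely generated as a normal subgroup. -/
theorem isFinitelyNormallyGenerated_ker {P G : Type*} [Group P] [Group G] (hP : Group.FG P)
    (hG : Group.IsFinitelyPresented G) (r : P →* G) (hr : Function.Surjective r) :
    r.ker.IsFinitelyNormallyGenerated := by
  obtain ⟨n, q, hq, s, hs, hsq⟩ := hG.out
  obtain ⟨t, ht, htf⟩ := Group.fg_iff.1 hP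
  choose x hx using fun i => hr (q (FreeGroup.of i))
  let l : FreeGroup (Fin n) →* P := FreeGroup.lift x
  have hl : r.comp l = q := by
    ext i
    simp [l, hx]
  choose v hv using fun a => hq (r a)
  let T : Set P := l '' s ∪ (fun a => a⁻¹ * l (v a)) '' t
  let N := Subgroup.normalClosure T
  refine ⟨T, (hs.image _).union (htf.image _), le_antisymm ?_ ?_⟩
  · refine Subgroup.normalClosure_le_normal ?_
    rintro _ (⟨y, hy, rfl⟩ | ⟨a, -, rfl⟩)
    · have h1 : y ∈ q.ker := hsq ▸ Subgroup.subset_normalClosure hy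
      rw [SetLike.mem_coe, MonoidHom.mem_ker, ← MonoidHom.comp_apply, hl]
      exact h1
    · rw [SetLike.mem_coe, MonoidHom.mem_ker, map_mul, map_inv, ← MonoidHom.comp_apply, hl, hv,
        inv_mul_cancel]
  · have h1 : q.ker ≤ ((QuotientGroup.mk' N).comp l).ker := by
      rw [← hsq]
      refine Subgroup.normalClosure_le_normal fun y hy => ?_
      exact (QuotientGroup.eq_one_iff _).2 (Subgroup.subset_normalClosure (.inl ⟨y, hy, rfl⟩))
    -- The inverse of the map induced by `r` on `P / N`.
    let j : G →* P ⧸ N := q.liftOfSurjective hq ⟨(QuotientGroup.mk' N).comp l, h1⟩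
    have hj : ∀ y, j (q y) = QuotientGroup.mk' N (l y) := fun y =>
      q.liftOfRightInverse_comp_apply _ (Function.rightInverse_surjInv hq) _ y
    have h2 : j.comp r = QuotientGroup.mk' N := by
      refine MonoidHom.eq_of_eqOn_dense ht fun a ha => ?_
      rw [MonoidHom.comp_apply, ← hv a, hj]
      exact (QuotientGroup.eq.2 (Subgroup.subset_normalClosure (.inr ⟨a, ha, rfl⟩))).symm
    intro y hy
    change y ∈ N
    rw [← QuotientGroup.ker_mk' N, MonoidHom.mem_ker, ← h2, MonoidHom.comp_apply, hy, map_one]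

end Generation

/-! ### Extension along homomorphisms in `Ω^R` -/

section Omega

open Monoid.Coprod
open scoped commutatorElement

variable {R : Subring ℚ}

/-- Homomorphisms from `P` to `R`-closed groups are trivial on a finitely normally generated
normal subgroup `K` if each element of `K` has a power in `[P, K]` with exponent a denominator of
`R`: the generators of `K` solve a system that is also solved by trivial elements. -/
theorem ker_le_ker_of_isRClosed {P G : Type u} [Group P] [Group G] (r : P →* G)
    (hr : r.ker.IsFinitelyNormallyGenerated)
    (h : ∀ k ∈ r.ker, ∃ e, IsDenominator R e ∧ k ^ e ∈ ⁅(⊤ : Subgroup P), r.ker⁆)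
    {A : Type u} [Group A] (hA : IsRClosed R A) (f : P →* A) : r.ker ≤ f.ker := by
  obtain ⟨T, hT, hTr⟩ := hr
  obtain ⟨m, k, -, rfl⟩ := hT.fin_param
  have hk : ∀ j, k j ∈ r.ker := fun j => hTr ▸ Subgroup.subset_normalClosure ⟨j, rfl⟩
  obtain ⟨e, he, hke⟩ := exists_common_denominator _ k fun j => h _ (hk j)
  let ev : Monoid.Coprod P (FreeGroup (Fin m)) →* P := NullSystem.value (MonoidHom.id P) k
  have hev : Function.Surjective ev := fun p => ⟨inl p, by simp [ev]⟩
  have h1 : r.ker ≤ (fst : Monoid.Coprod P (FreeGroup (Fin m)) →* P).ker.map ev := by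
    have : ((fst : Monoid.Coprod P (FreeGroup (Fin m)) →* P).ker.map ev).Normal :=
      (MonoidHom.normal_ker _).map ev hev
    rw [← hTr]
    refine Subgroup.normalClosure_le_normal ?_
    rintro _ ⟨j, rfl⟩
    exact ⟨inr (FreeGroup.of j), by simp [MonoidHom.mem_ker], by simp [ev]⟩
  have h2 : ∀ j, ∃ w ∈ ⁅(⊤ : Subgroup (Monoid.Coprod P (FreeGroup (Fin m)))), fst.ker⁆,
      ev w = k j ^ e := by
    intro j
    have h3 := Subgroup.commutator_mono le_rfl h1 (hke j)
    rw [← Subgroup.map_top_of_surjective ev hev, ← Subgroup.map_commutator] at h3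
    exact h3
  choose w hw hwk using h2
  let S : NullSystem R P :=
    { n := m
      e := e
      e_mem := he
      w := w
      null := fun i => by
        have h4 : w i ∈ commutator (Monoid.Coprod P (FreeGroup (Fin m))) :=
          Subgroup.commutator_mono le_rfl le_top (hw i)
        exact Abelianization.commutator_subset_ker (Abelianization.of.comp snd) h4 }
  have hS : S.IsSolution k := fun i => (hwk i).symm
  have hS1 : S.IsSolution fun _ => 1 := by
    intro i
    have h5 : (Monoid.Coprod.lift (MonoidHom.id P) (FreeGroup.lift fun _ : Fin m => (1 : P))) =
        fst := Monoid.Coprod.hom_ext (by ext; simp) (by ext; simp)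
    have h6 : fst (w i) = (1 : P) :=
      Subgroup.commutator_le_right (⊤ : Subgroup (Monoid.Coprod P (FreeGroup (Fin m)))) _ (hw i)
    exact (one_pow e).trans ((DFunLike.congr_fun h5 (w i)).trans h6).symm
  have h7 := (hA (S.map f)).unique (NullSystem.isSolution_map_iff.2 (hS.isSolutionIn f))
    (NullSystem.isSolution_map_iff.2 (hS1.isSolutionIn f))
  rw [← hTr]
  refine Subgroup.normalClosure_le_normal ?_
  rintro _ ⟨j, rfl⟩
  exact (congrFun h7 j).trans (map_one f)

/-- Homomorphisms to `R`-closed groups extend uniquely along the homomorphisms in `Ω^R`. -/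
theorem Omega.existsUnique_extension {π G : GrpCat.{u}} {α : π ⟶ G} (hα : Omega R α)
    {A : Type u} [Group A] (hA : IsRClosed R A) (φ : π →* A) :
    ∃! χ : G →* A, χ.comp α.hom = φ := by
  obtain ⟨hπ, hG, ⟨hinj, hsurj⟩, hsurj₂⟩ := hα
  obtain ⟨n, q, hq, hqk⟩ := hG.out
  -- Since `H_1(α; R)` is onto, the generators of `G` satisfy equations `g_i ^ e = α(h_i) c_i`.
  obtain ⟨e, he, hge⟩ := exists_common_denominator _ (fun i => q (FreeGroup.of i))
    fun i => exists_pow_mem_range_sup_commutator α.hom hsurj (q (FreeGroup.of i))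
  have h1 : ∀ i, ∃ (h : π) (c : FreeGroup (Fin n)), c ∈ commutator (FreeGroup (Fin n)) ∧
      α.hom h * q c = q (FreeGroup.of i) ^ e := by
    intro i
    have h2 : q (FreeGroup.of i) ^ e ∈ ((α.hom.range ⊔ commutator G : Subgroup G) : Set G) := hge i
    rw [Subgroup.mul_normal, Set.mem_mul] at h2
    obtain ⟨_, ⟨h, rfl⟩, c, hc, hh⟩ := h2
    have h3 : commutator G = (commutator (FreeGroup (Fin n))).map q := by
      rw [commutator_def, commutator_def, Subgroup.map_commutator,
        Subgroup.map_top_of_surjective q hq]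
    rw [h3] at hc
    obtain ⟨c, hc, rfl⟩ := hc
    exact ⟨h, c, hc, hh⟩
  choose h c hc hhc using h1
  let S : NullSystem R π :=
    { n := n
      e := e
      e_mem := he
      w := fun i => inl (h i) * inr (c i)
      null := fun i => by
        rw [map_mul, snd_apply_inl, snd_apply_inr, one_mul, ← MonoidHom.mem_ker,
          Abelianization.ker_of]
        exact hc i }
  have hlift : FreeGroup.lift (fun i => q (FreeGroup.of i)) = q := by
    ext
    simp
  have hS : S.IsSolutionIn α.hom fun i => q (FreeGroup.of i) := by
    intro i
    change _ = NullSystem.value α.hom _ (inl (h i) * inr (c i))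
    rw [map_mul, lift_apply_inl, lift_apply_inr, hlift, hhc]
  let r : S.Adjoin →* G := S.adjoinLift α.hom _ hS
  have hrα : r.comp S.toAdjoin = α.hom := S.adjoinLift_comp_toAdjoin _ _ hS
  have hr : Function.Surjective r := by
    have h4 : r.comp (FreeGroup.lift S.root) = q := by
      ext i
      rw [MonoidHom.comp_apply, FreeGroup.lift_apply_of]
      exact S.adjoinLift_root _ _ hS i
    refine Function.Surjective.of_comp (g := FreeGroup.lift S.root) ?_
    rw [← MonoidHom.coe_comp, h4]
    exact hq
  have horth := S.leftOrthogonal_toAdjoin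
  have hcomp : ∀ j, ⇑(homologyMapWith R α.hom j) =
      homologyMapWith R r j ∘ homologyMapWith R S.toAdjoin j := by
    intro j
    rw [← hrα, homologyMapWith_comp]
    rfl
  have hr₁ : Function.Injective (homologyMapWith R r 1) := by
    rw [hcomp] at hinj
    exact hinj.of_comp_right horth.homologyMapWith_one_surjective
  have hr₂ : Function.Surjective (homologyMapWith R r 2) := by
    rw [hcomp] at hsurj₂
    exact hsurj₂.of_comp
  have hfg : Group.FG S.Adjoin := by
    have := Monoid.Coprod.group_fg hπ (inferInstance : Group.FG (FreeGroup (Fin n)))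
    exact Group.fg_of_surjective (QuotientGroup.mk'_surjective _)
  obtain ⟨f, hf, hfu⟩ := horth.existsUnique_extension hA φ
  have hker := ker_le_ker_of_isRClosed (R := R) r (isFinitelyNormallyGenerated_ker hfg hG r hr)
    (fun k hk => exists_pow_mem_commutator_ker r hr hr₁ hr₂ hk) hA f
  let χ : G →* A := r.liftOfSurjective hr ⟨f, hker⟩
  have hχ : χ.comp r = f := r.liftOfRightInverse_comp _ (Function.rightInverse_surjInv hr) _
  refine ⟨χ, ?_, fun χ' hχ' => ?_⟩
  · change χ.comp α.hom = φ
    rw [← hrα, ← MonoidHom.comp_assoc, hχ, hf]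
  · have h8 : χ'.comp r = f := hfu _ (by
      change (χ'.comp r).comp S.toAdjoin = φ
      rw [MonoidHom.comp_assoc, hrα, hχ'])
    rw [← hχ] at h8
    exact (MonoidHom.cancel_right hr).1 h8

end Omega

/-! ### Existence of `R`-closures -/

section Closure

variable {R : Subring ℚ}

namespace NullSystem

/-- A system descends along a homomorphism if each of its words does. -/
theorem exists_map_eq_of_mem_range {A B : Type*} [Group A] [Group B] (f : A →* B)
    (S : NullSystem R B)
    (h : ∀ i, S.w i ∈ (Monoid.Coprod.map f (MonoidHom.id (FreeGroup (Fin S.n)))).range) :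
    ∃ S' : NullSystem R A, S'.map f = S := by
  obtain ⟨n, e, he, w, hw⟩ := S
  change ∀ i, w i ∈ (Monoid.Coprod.map f (MonoidHom.id (FreeGroup (Fin n)))).range at h
  choose w' hw' using h
  obtain rfl : (fun i => Monoid.Coprod.map f (MonoidHom.id _) (w' i)) = w := funext hw'
  refine ⟨⟨n, e, he, w', fun i => ?_⟩, rfl⟩
  have h1 : (Monoid.Coprod.snd : Monoid.Coprod B (FreeGroup (Fin n)) →* _).comp
      (Monoid.Coprod.map f (MonoidHom.id _)) = Monoid.Coprod.snd :=
    Monoid.Coprod.hom_ext (by ext; simp) (by ext; simp)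
  rw [← h1]
  exact hw i

/-- Only finitely many constants appear in an element of `A * F`. -/
theorem exists_finite_constants {A F : Type*} [Group A] [Group F] (w : Monoid.Coprod A F) :
    ∃ s : Set A, s.Finite ∧ ∀ c : ℕ → A, s ⊆ Set.range c →
      w ∈ (Monoid.Coprod.map (FreeGroup.lift c) (MonoidHom.id F)).range := by
  induction w using Monoid.Coprod.induction_on with
  | inl a =>
    refine ⟨{a}, Set.finite_singleton a, fun c hc => ?_⟩
    obtain ⟨j, rfl⟩ := hc rfl
    exact ⟨Monoid.Coprod.inl (FreeGroup.of j), by simp⟩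
  | inr b => exact ⟨∅, Set.finite_empty, fun c _ => ⟨Monoid.Coprod.inr b, by simp⟩⟩
  | mul x y hx hy =>
    obtain ⟨s, hs, hsc⟩ := hx
    obtain ⟨t, ht, htc⟩ := hy
    exact ⟨s ∪ t, hs.union ht, fun c hc => Subgroup.mul_mem _
      (hsc c (Set.subset_union_left.trans hc)) (htc c (Set.subset_union_right.trans hc))⟩

/-- Every system arises by substitution from a system over a free group of countable rank. -/
theorem exists_map_lift_eq {A : Type*} [Group A] (S : NullSystem R A) :
    ∃ (c : ℕ → A) (D : NullSystem R (FreeGroup ℕ)), D.map (FreeGroup.lift c) = S := by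
  choose s hs hsc using fun i => exists_finite_constants (S.w i)
  obtain ⟨c, hc⟩ := ((Set.finite_iUnion hs).insert 1).countable.exists_eq_range
    (Set.insert_nonempty _ _)
  exact ⟨c, exists_map_eq_of_mem_range _ S fun i => hsc i c
    (hc ▸ (Set.subset_iUnion s i).trans (Set.subset_insert _ _))⟩

end NullSystem

/-- Formal expressions in elements of `G`, the group operations and solutions of
`R`-nullhomologous systems: `root D i c` stands for the `i`-th component of the solution of the
system `D` with the constants `c`. -/
inductive ClosureTerm (R : Subring ℚ) (G : Type u) : Type u
  | of (g : G)
  | one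
  | mul (s t : ClosureTerm R G)
  | inv (t : ClosureTerm R G)
  | root (D : NullSystem R (FreeGroup ℕ)) (i : Fin D.n) (c : ℕ → ClosureTerm R G)

namespace ClosureTerm

variable {G : Type u} [Group G]

/-- The value of an expression in an `R`-closed group. -/
def eval {A : Type u} [Group A] (hA : IsRClosed R A) (φ : G →* A) : ClosureTerm R G → A
  | of g => φ g
  | one => 1
  | mul s t => eval hA φ s * eval hA φ t
  | inv t => (eval hA φ t)⁻¹
  | root D i c => (hA (D.map (FreeGroup.lift fun k => eval hA φ (c k)))).choose i

variable (R G) in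
/-- Two expressions are equivalent if they have the same values in all `R`-closed groups. -/
instance setoid : Setoid (ClosureTerm R G) where
  r s t := ∀ (A : Type u) [Group A] (hA : IsRClosed R A) (φ : G →* A), eval hA φ s = eval hA φ t
  iseqv :=
    { refl := fun _ _ _ _ _ => rfl
      symm := fun h A _ hA φ => (h A hA φ).symm
      trans := fun h h' A _ hA φ => (h A hA φ).trans (h' A hA φ) }

theorem eval_eq_of_equiv {s t : ClosureTerm R G} (h : s ≈ t) {A : Type u} [Group A]
    (hA : IsRClosed R A) (φ : G →* A) : eval hA φ s = eval hA φ t :=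
  by exact h A hA φ

end ClosureTerm

/-- The `R`-closure of a group: expressions up to equality of their values in all `R`-closed
groups. -/
def RClosure (R : Subring ℚ) (G : Type u) [Group G] : Type u :=
  Quotient (ClosureTerm.setoid R G)

namespace RClosure

variable {G : Type u} [Group G]

/-- The element of the `R`-closure represented by an expression. -/
def mk (t : ClosureTerm R G) : RClosure R G := Quotient.mk _ t

theorem mk_surjective : Function.Surjective (mk : ClosureTerm R G → RClosure R G) :=
  Quotient.mk_surjective

/-- The value of an element of the `R`-closure in an `R`-closed group. -/
def evalFun {A : Type u} [Group A] (hA : IsRClosed R A) (φ : G →* A) (x : RClosure R G) : A :=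
  Quotient.lift (ClosureTerm.eval hA φ) (fun _ _ h => ClosureTerm.eval_eq_of_equiv h hA φ) x

theorem ext_evalFun {x y : RClosure R G}
    (h : ∀ (A : Type u) [Group A] (hA : IsRClosed R A) (φ : G →* A),
      evalFun hA φ x = evalFun hA φ y) : x = y := by
  obtain ⟨x, rfl⟩ := mk_surjective x
  obtain ⟨y, rfl⟩ := mk_surjective y
  exact Quotient.sound fun A _ hA φ => h A hA φ

instance : Mul (RClosure R G) :=
  ⟨Quotient.map₂ ClosureTerm.mul fun _ _ h _ _ h' _ _ hA φ =>
    congrArg₂ (· * ·) (ClosureTerm.eval_eq_of_equiv h hA φ)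
      (ClosureTerm.eval_eq_of_equiv h' hA φ)⟩

instance : Inv (RClosure R G) :=
  ⟨Quotient.map ClosureTerm.inv fun _ _ h _ _ hA φ =>
    congrArg (·⁻¹) (ClosureTerm.eval_eq_of_equiv h hA φ)⟩

instance : One (RClosure R G) := ⟨mk ClosureTerm.one⟩

theorem evalFun_mul {A : Type u} [Group A] (hA : IsRClosed R A) (φ : G →* A)
    (x y : RClosure R G) : evalFun hA φ (x * y) = evalFun hA φ x * evalFun hA φ y := by
  obtain ⟨x, rfl⟩ := mk_surjective x
  obtain ⟨y, rfl⟩ := mk_surjective y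
  rfl

theorem evalFun_inv {A : Type u} [Group A] (hA : IsRClosed R A) (φ : G →* A)
    (x : RClosure R G) : evalFun hA φ x⁻¹ = (evalFun hA φ x)⁻¹ := by
  obtain ⟨x, rfl⟩ := mk_surjective x
  rfl

theorem evalFun_one {A : Type u} [Group A] (hA : IsRClosed R A) (φ : G →* A) :
    evalFun hA φ (1 : RClosure R G) = 1 := rfl

instance : Group (RClosure R G) :=
  Group.ofLeftAxioms
    (fun x y z => ext_evalFun fun _ _ _ _ => by simp only [evalFun_mul, mul_assoc])
    (fun x => ext_evalFun fun _ _ _ _ => by simp only [evalFun_mul, evalFun_one, one_mul])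
    (fun x => ext_evalFun fun _ _ _ _ => by
      simp only [evalFun_mul, evalFun_inv, evalFun_one, inv_mul_cancel])

/-- The extension of a homomorphism from `G` to an `R`-closed group to the `R`-closure. -/
def eval {A : Type u} [Group A] (hA : IsRClosed R A) (φ : G →* A) : RClosure R G →* A where
  toFun := evalFun hA φ
  map_one' := rfl
  map_mul' := evalFun_mul hA φ

theorem ext_eval {x y : RClosure R G}
    (h : ∀ (A : Type u) [Group A] (hA : IsRClosed R A) (φ : G →* A), eval hA φ x = eval hA φ y) :
    x = y :=
  ext_evalFun h

variable (R G) in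
/-- The canonical homomorphism to the `R`-closure. -/
def of : G →* RClosure R G where
  toFun g := mk (ClosureTerm.of g)
  map_one' := ext_evalFun fun _ _ _ φ => map_one φ
  map_mul' g h := ext_evalFun fun _ _ _ φ => map_mul φ g h

theorem eval_comp_of {A : Type u} [Group A] (hA : IsRClosed R A) (φ : G →* A) :
    (eval hA φ).comp (of R G) = φ := rfl

theorem eval_comp_lift {A : Type u} [Group A] (hA : IsRClosed R A) (φ : G →* A)
    (c : ℕ → ClosureTerm R G) :
    (eval hA φ).comp (FreeGroup.lift fun k => mk (c k)) =
      FreeGroup.lift fun k => ClosureTerm.eval hA φ (c k) := by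
  ext k
  simp only [MonoidHom.comp_apply, FreeGroup.lift_apply_of]
  rfl

theorem isSolutionIn_root (D : NullSystem R (FreeGroup ℕ)) (c : ℕ → ClosureTerm R G) :
    D.IsSolutionIn (FreeGroup.lift fun k => mk (c k))
      fun i => mk (ClosureTerm.root D i c) := by
  refine fun i => ext_eval fun A _ hA φ => ?_
  have h := NullSystem.isSolution_map_iff.1
    (hA (D.map (FreeGroup.lift fun k => ClosureTerm.eval hA φ (c k)))).choose_spec.1 i
  rw [NullSystem.map_value, eval_comp_lift, map_pow]
  exact h

theorem isRClosed : IsRClosed R (RClosure R G) := by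
  intro S
  obtain ⟨c, D, rfl⟩ := S.exists_map_lift_eq
  obtain ⟨t, rfl⟩ : ∃ t : ℕ → ClosureTerm R G, (fun k => mk (t k)) = c :=
    ⟨fun k => (mk_surjective (c k)).choose, funext fun k => (mk_surjective (c k)).choose_spec⟩
  refine ⟨fun i => mk (ClosureTerm.root D i t),
    NullSystem.isSolution_map_iff.2 (isSolutionIn_root D t), fun b hb => ?_⟩
  refine funext fun i => ext_eval fun A _ hA φ => ?_
  have h := ((NullSystem.isSolution_map_iff (S := D)).1 hb).comp (eval hA φ)
  rw [eval_comp_lift, ← NullSystem.isSolution_map_iff] at h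
  exact congrFun ((hA (D.map (FreeGroup.lift fun k => ClosureTerm.eval hA φ
    (t k)))).choose_spec.2 _ h) i

theorem eq_eval {A : Type u} [Group A] (hA : IsRClosed R A) (ψ : RClosure R G →* A) :
    ψ = eval hA (ψ.comp (of R G)) := by
  ext x
  obtain ⟨t, rfl⟩ := mk_surjective x
  change _ = ClosureTerm.eval hA _ t
  induction t with
  | of g => rfl
  | one => exact map_one ψ
  | mul s t hs ht =>
    exact (map_mul ψ (mk s) (mk t)).trans (congrArg₂ (· * ·) hs ht)
  | inv t ht => exact (map_inv ψ (mk t)).trans (congrArg (·⁻¹) ht)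
  | root D i c hc =>
    have h := (isSolutionIn_root D c).comp ψ
    have h1 : ψ.comp (FreeGroup.lift fun k => mk (c k)) =
        FreeGroup.lift fun k => ClosureTerm.eval hA (ψ.comp (of R G)) (c k) := by
      ext k
      simpa using hc k
    rw [h1, ← NullSystem.isSolution_map_iff] at h
    exact congrFun ((hA (D.map (FreeGroup.lift fun k => ClosureTerm.eval hA
      (ψ.comp (of R G)) (c k)))).choose_spec.2 _ h) i

theorem hom_ext {A : Type u} [Group A] (hA : IsRClosed R A) {ψ ψ' : RClosure R G →* A}
    (h : ψ.comp (of R G) = ψ'.comp (of R G)) : ψ = ψ' := by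
  rw [eq_eval hA ψ, eq_eval hA ψ', h]

variable (R) in
/-- The `R`-closure as a functor. -/
@[simps obj map]
def functor : GrpCat.{u} ⥤ GrpCat.{u} where
  obj G := GrpCat.of (RClosure R G)
  map {_ H} f := GrpCat.ofHom (eval isRClosed ((of R H).comp f.hom))
  map_id _ := GrpCat.hom_ext (hom_ext isRClosed rfl)
  map_comp _ _ := GrpCat.hom_ext (hom_ext isRClosed rfl)

variable (R) in
/-- The canonical homomorphisms to the `R`-closures, as a natural transformation. -/
@[simps app]
def unit : 𝟭 GrpCat.{u} ⟶ functor.{u} R where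
  app G := GrpCat.ofHom (of R G)

theorem isRClosure_unit (G : GrpCat.{u}) : IsRClosure R ((unit R).app G) := by
  refine ⟨isRClosed, fun A hA φ => ⟨GrpCat.ofHom (eval hA φ.hom), ?_, fun ψ hψ => ?_⟩⟩
  · exact GrpCat.hom_ext (eval_comp_of hA φ.hom)
  · refine GrpCat.hom_ext (hom_ext hA ?_)
    exact congrArg GrpCat.Hom.hom hψ

end RClosure

end Closure

/-! ### Construction of sequences by dovetailing -/

section Sequence

universe v w

variable {C : Type u} [Category.{v} C] (T : C → Type w) (Done : ∀ {X Y : C}, T X → (X ⟶ Y) → Prop)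

/-- A stage of the construction of a sequence: an object together with a table of tasks set at
objects that map to it. -/
abbrev TaskStage := Σ X : C, ℕ → ℕ → Σ W : C, T W × (W ⟶ X)

variable {T} {Done}
variable (step : ∀ {X Y : C} (t : T X) (f : X ⟶ Y), ∃ (Z : C) (g : Y ⟶ Z), Done t (f ≫ g))
  (enum : ∀ X : C, ℕ → T X)

namespace TaskStage

/-- The task that is dealt with in step `N`. -/
def current (N : ℕ) (s : TaskStage T) : Σ W : C, T W × (W ⟶ s.1) :=
  s.2 N.unpair.1 N.unpair.2

/-- The next stage: deal with the current task, and enter the tasks set at the new object in the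
row `N + 1` of the table. -/
def next (N : ℕ) (s : TaskStage T) : TaskStage T :=
  ⟨(step (s.current N).2.1 (s.current N).2.2).choose, fun k j =>
    if k = N + 1 then ⟨_, enum _ j, 𝟙 _⟩
    else ⟨(s.2 k j).1, (s.2 k j).2.1,
      (s.2 k j).2.2 ≫ (step (s.current N).2.1 (s.current N).2.2).choose_spec.choose⟩⟩

/-- The morphism to the next stage. -/
def toNext (N : ℕ) (s : TaskStage T) : s.1 ⟶ (next step enum N s).1 :=
  (step (s.current N).2.1 (s.current N).2.2).choose_spec.choose

theorem done_toNext (N : ℕ) (s : TaskStage T) :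
    Done (s.current N).2.1 ((s.current N).2.2 ≫ s.toNext step enum N) :=
  (step (s.current N).2.1 (s.current N).2.2).choose_spec.choose_spec

/-- The sequence of stages, starting from `G`. -/
def stage (G : C) : ℕ → TaskStage T
  | 0 => ⟨G, fun _ j => ⟨G, enum G j, 𝟙 G⟩⟩
  | N + 1 => next step enum N (stage G N)

/-- The sequence of the objects of the stages. -/
def sequence (G : C) : ℕ ⥤ C :=
  Functor.ofSequence (X := fun N => (stage step enum G N).1)
    fun N => (stage step enum G N).toNext step enum N

theorem stage_table (G : C) (k j d : ℕ) :
    (stage step enum G (k + d)).2 k j =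
      ⟨(stage step enum G k).1, enum _ j,
        (sequence step enum G).map (homOfLE (Nat.le_add_right k d))⟩ := by
  induction d with
  | zero =>
    have h : (sequence step enum G).map (homOfLE (Nat.le_add_right k 0)) = 𝟙 _ :=
      (sequence step enum G).map_id k
    rw [h]
    cases k with
    | zero => rfl
    | succ k => exact if_pos rfl
  | succ d ih =>
    have h : (stage step enum G (k + (d + 1))).2 k j =
        ⟨((stage step enum G (k + d)).2 k j).1, ((stage step enum G (k + d)).2 k j).2.1,
          ((stage step enum G (k + d)).2 k j).2.2 ≫
            (stage step enum G (k + d)).toNext step enum (k + d)⟩ :=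
      if_neg (show ¬k = k + d + 1 by omega)
    rw [h, ih]
    have h2 : (sequence step enum G).map (homOfLE (Nat.le_add_right k (d + 1))) =
        (sequence step enum G).map (homOfLE (Nat.le_add_right k d)) ≫
          (stage step enum G (k + d)).toNext step enum (k + d) := by
      have h3 := Functor.ofSequence_map_homOfLE_succ
        (fun N => (stage step enum G N).toNext step enum N) (k + d)
      rw [← h3]
      exact (sequence step enum G).map_comp (homOfLE (Nat.le_add_right k d))
        (homOfLE (Nat.le_add_right (k + d) 1))
    rw [h2]
    rfl

end TaskStage

/-- Dovetailing: if each object carries countably many tasks and each task can be done by passing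
to another object, then there is a sequence along which all tasks are done. -/
theorem exists_sequence_done [∀ X, Countable (T X)] [∀ X, Nonempty (T X)]
    (step : ∀ {X Y : C} (t : T X) (f : X ⟶ Y), ∃ (Z : C) (g : Y ⟶ Z), Done t (f ≫ g)) (G : C) :
    ∃ F : ℕ ⥤ C, F.obj 0 = G ∧ ∀ (k : ℕ) (t : T (F.obj k)), ∃ (N : ℕ) (h : k ⟶ N),
      Done t (F.map h) := by
  choose enum henum using fun X => exists_surjective_nat (T X)
  refine ⟨TaskStage.sequence step enum G, rfl, fun k t => ?_⟩
  obtain ⟨j, rfl⟩ := henum _ t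
  obtain ⟨d, hd⟩ := Nat.exists_eq_add_of_le (Nat.left_le_pair k j)
  have h1 := TaskStage.done_toNext step enum (Nat.pair k j)
    (TaskStage.stage step enum G (Nat.pair k j))
  have h2 : (TaskStage.stage step enum G (Nat.pair k j)).current (Nat.pair k j) =
      ⟨_, enum _ j, (TaskStage.sequence step enum G).map (homOfLE (Nat.left_le_pair k j))⟩ := by
    rw [TaskStage.current, Nat.unpair_pair]
    have h3 := TaskStage.stage_table step enum G k j d
    revert h3
    generalize_proofs p q
    revert p q
    rw [← hd]
    exact fun p q h => h
  refine ⟨Nat.pair k j + 1, homOfLE (Nat.le_succ_of_le (Nat.left_le_pair k j)), ?_⟩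
  have h4 : (TaskStage.sequence step enum G).map
      (homOfLE (Nat.le_succ_of_le (Nat.left_le_pair k j))) =
      (TaskStage.sequence step enum G).map (homOfLE (Nat.left_le_pair k j)) ≫
        (TaskStage.stage step enum G (Nat.pair k j)).toNext step enum (Nat.pair k j) := by
    have h5 := Functor.ofSequence_map_homOfLE_succ
      (fun N => (TaskStage.stage step enum G N).toNext step enum N) (Nat.pair k j)
    rw [← h5]
    exact (TaskStage.sequence step enum G).map_comp (homOfLE (Nat.left_le_pair k j))
      (homOfLE (Nat.le_add_right (Nat.pair k j) 1))
  rw [h4]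
  rw [h2] at h1
  exact h1

end Sequence

/-! ### Sequences of finitely presented groups with `R`-closed colimit -/

section Countable

variable {R : Subring ℚ}

theorem Group.IsFinitelyPresented.countable {G : Type*} [Group G]
    (h : Group.IsFinitelyPresented G) : Countable G := by
  obtain ⟨n, φ, hφ, -⟩ := h.out
  exact hφ.countable

instance countable_coprod {A B : Type*} [Group A] [Group B] [Countable A] [Countable B] :
    Countable (Monoid.Coprod A B) := by
  have : Countable (FreeMonoid (A ⊕ B)) := inferInstanceAs (Countable (List (A ⊕ B)))
  exact Monoid.Coprod.mk_surjective.countable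

instance countable_nullSystem {A : Type*} [Group A] [Countable A] :
    Countable (NullSystem R A) := by
  have h : Function.Injective (fun S : NullSystem R A =>
      (⟨S.n, S.e, S.w⟩ : Σ n : ℕ, ℕ × (Fin n → Monoid.Coprod A (FreeGroup (Fin n))))) := by
    rintro ⟨n, e, he, w, hw⟩ ⟨n', e', he', w', hw'⟩ h
    obtain ⟨rfl, h⟩ := Sigma.mk.inj_iff.1 h
    obtain ⟨rfl, rfl⟩ := Prod.mk_inj.1 (eq_of_heq h)
    rfl
  exact h.countable

/-- A system over `A` and two candidates for solutions. -/
abbrev SolutionTask (R : Subring ℚ) (A : Type*) [Group A] :=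
  Σ S : NullSystem R A, (Fin S.n → A) × (Fin S.n → A)

instance nonempty_solutionTask {A : Type*} [Group A] : Nonempty (SolutionTask R A) :=
  ⟨⟨0, 1, isDenominator_one R, nofun, nofun⟩, nofun, nofun⟩

/-- The system has a solution in `B`, and the candidates, if they are solutions, become equal. -/
def SolutionTask.Done {A B : Type*} [Group A] [Group B] (t : SolutionTask R A) (f : A →* B) :
    Prop :=
  (∃ b, t.1.IsSolutionIn f b) ∧
    (t.1.IsSolution t.2.1 → t.1.IsSolution t.2.2 → f ∘ t.2.1 = f ∘ t.2.2)

theorem LeftOrthogonal.comp {X Y Z : Type u} [Group X] [Group Y] [Group Z] {f : X →* Y}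
    {g : Y →* Z} (hg : LeftOrthogonal R g) (hf : LeftOrthogonal R f) :
    LeftOrthogonal R (g.comp f) := by
  intro E B _ _ p hp φ ψ h
  obtain ⟨χ, ⟨h₁, h₂⟩, hu⟩ := hf E B p hp φ (ψ.comp g) h
  obtain ⟨ξ, ⟨h₃, h₄⟩, hv⟩ := hg E B p hp χ ψ h₂.symm
  refine ⟨ξ, ⟨by rw [← MonoidHom.comp_assoc, h₃, h₁], h₄⟩, fun ξ' h' => hv ξ' ⟨?_, h'.2⟩⟩
  exact hu _ ⟨h'.1, by rw [← h'.2]; rfl⟩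

/-- Each task can be done in a finitely presented group. -/
theorem SolutionTask.exists_done {X Y : Type u} [Group X] [Group Y]
    (hY : Group.IsFinitelyPresented Y) (t : SolutionTask R X) (f : X →* Y) :
    ∃ (Z : Type u) (_ : Group Z) (g : Y →* Z), Group.IsFinitelyPresented Z ∧
      LeftOrthogonal R g ∧ t.Done (g.comp f) := by
  obtain ⟨S, a, b⟩ := t
  let S₁ := S.map f
  have h₁ : Group.IsFinitelyPresented S₁.Adjoin :=
    Group.IsFinitelyPresented.quotient _ ⟨_, Set.finite_range _, rfl⟩
  let g₁ : Y →* S₁.Adjoin := S₁.toAdjoin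
  have hr : S.IsSolutionIn (g₁.comp f) S₁.root :=
    NullSystem.isSolutionIn_map_iff.1 S₁.isSolutionIn_root
  by_cases hab : S.IsSolution a ∧ S.IsSolution b
  · let f₁ := g₁.comp f
    have ha : (S.map f₁).IsSolution (f₁ ∘ a) :=
      NullSystem.isSolution_map_iff.2 (hab.1.isSolutionIn f₁)
    have hb : (S.map f₁).IsSolution (f₁ ∘ b) :=
      NullSystem.isSolution_map_iff.2 (hab.2.isSolutionIn f₁)
    have h₂ : Group.IsFinitelyPresented (NullSystem.Identify (f₁ ∘ a) (f₁ ∘ b)) :=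
      Group.IsFinitelyPresented.quotient _ ⟨_, Set.finite_range _, rfl⟩
    let g₂ : S₁.Adjoin →* NullSystem.Identify (f₁ ∘ a) (f₁ ∘ b) := QuotientGroup.mk' _
    refine ⟨_, _, g₂.comp g₁, h₂, (NullSystem.leftOrthogonal_identify _ ha hb).comp
      S₁.leftOrthogonal_toAdjoin, ⟨_, hr.comp g₂⟩, fun _ _ => funext fun i => ?_⟩
    exact QuotientGroup.eq.2 (Subgroup.subset_normalClosure ⟨i, rfl⟩)
  · exact ⟨_, _, g₁, h₁, S₁.leftOrthogonal_toAdjoin, ⟨_, hr⟩, fun h h' => absurd ⟨h, h'⟩ hab⟩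

instance preservesColimitsOfShape_nat_forget : PreservesColimitsOfShape ℕ (forget GrpCat.{u}) := by
  have : PreservesFilteredColimitsOfSize.{0, 0} (forget GrpCat.{u}) :=
    preservesFilteredColimitsOfSize_shrink.{0, u, 0, u} _
  exact PreservesFilteredColimitsOfSize.preserves_filtered_colimits ℕ

theorem exists_rep_of_isColimit {F : ℕ ⥤ GrpCat.{u}} {c : Cocone F} (hc : IsColimit c)
    {ι : Type*} [Finite ι] (x : ι → c.pt) : ∃ i : ℕ, ∀ j, i ≤ j →
      ∃ y : ι → F.obj j, (c.ι.app j).hom ∘ y = x := by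
  choose i y hy using fun k => Concrete.isColimit_exists_rep F hc (x k)
  obtain ⟨i', hi'⟩ := (Set.finite_range i).bddAbove
  refine ⟨i', fun j hj => ⟨fun k => (F.map (homOfLE ((hi' ⟨k, rfl⟩).trans hj))).hom (y k),
    funext fun k => ?_⟩⟩
  exact (ConcreteCategory.congr_hom (c.w (homOfLE ((hi' ⟨k, rfl⟩).trans hj))) (y k)).trans (hy k)

theorem exists_eq_of_isColimit {F : ℕ ⥤ GrpCat.{u}} {c : Cocone F} (hc : IsColimit c)
    {ι : Type*} [Finite ι] {i : ℕ} (x y : ι → F.obj i)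
    (hxy : (c.ι.app i).hom ∘ x = (c.ι.app i).hom ∘ y) :
    ∃ (j : ℕ) (h : i ⟶ j), (F.map h).hom ∘ x = (F.map h).hom ∘ y := by
  choose j hj hj' using fun k => (hc.eq_iff' (x k) (y k)).1 (congrFun hxy k)
  obtain ⟨j', hj''⟩ := ((Set.finite_range j).insert i).bddAbove
  refine ⟨j', homOfLE (hj'' (Set.mem_insert _ _)), funext fun k => ?_⟩
  have h1 : F.map (homOfLE (hj'' (Set.mem_insert i _))) =
      F.map (hj k) ≫ F.map (homOfLE (hj'' (Set.mem_insert_of_mem _ ⟨k, rfl⟩))) := by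
    rw [← F.map_comp]
    rfl
  change (F.map _).hom (x k) = (F.map _).hom (y k)
  rw [h1]
  exact congrArg (F.map _).hom (hj' k)

/-- Homomorphisms from a finitely generated group that become equal in a sequential colimit become
equal at a finite stage. -/
theorem exists_comp_map_eq_of_isColimit {F : ℕ ⥤ GrpCat.{u}} {c : Cocone F} (hc : IsColimit c)
    {X : GrpCat.{u}} (hX : Group.FG X) {i : ℕ} (f g : X ⟶ F.obj i)
    (hfg : f ≫ c.ι.app i = g ≫ c.ι.app i) : ∃ (j : ℕ) (h : i ⟶ j), f ≫ F.map h = g ≫ F.map h := by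
  obtain ⟨S, hS, hfin⟩ := Group.fg_iff.1 hX
  have := hfin.to_subtype
  obtain ⟨j, h, hj⟩ := exists_eq_of_isColimit hc (fun s : S => f.hom s) (fun s : S => g.hom s)
    (funext fun s => ConcreteCategory.congr_hom hfg (s : X))
  exact ⟨j, h, GrpCat.hom_ext (MonoidHom.eq_of_eqOn_dense hS fun s hs => congrFun hj ⟨s, hs⟩)⟩

/-- A homomorphism from a finitely presented group to a sequential colimit factors through a
finite stage. -/
theorem exists_factorization_of_isColimit {F : ℕ ⥤ GrpCat.{u}} {c : Cocone F} (hc : IsColimit c)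
    {X : GrpCat.{u}} (hX : Group.IsFinitelyPresented X) (f : X ⟶ c.pt) :
    ∃ (i : ℕ) (g : X ⟶ F.obj i), g ≫ c.ι.app i = f := by
  obtain ⟨n, φ, hφ, S, hS, hker⟩ := hX.out
  have := hS.to_subtype
  obtain ⟨i, hi⟩ := exists_rep_of_isColimit hc fun k => f.hom (φ (FreeGroup.of k))
  obtain ⟨y, hy⟩ := hi i le_rfl
  have h1 : (c.ι.app i).hom.comp (FreeGroup.lift y) = f.hom.comp φ := by
    ext k
    simpa using congrFun hy k
  obtain ⟨j, h, hj⟩ := exists_eq_of_isColimit hc (fun s : S => FreeGroup.lift y s) (fun _ => 1)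
    (funext fun s => by
      have h2 : φ s = 1 := (hker ▸ Subgroup.subset_normalClosure s.2 : (s : FreeGroup _) ∈ φ.ker)
      have h3 := DFunLike.congr_fun h1 (s : FreeGroup (Fin n))
      simpa [h2] using h3)
  have h4 : φ.ker ≤ ((F.map h).hom.comp (FreeGroup.lift y)).ker := by
    rw [← hker]
    refine Subgroup.normalClosure_le_normal fun s hs => ?_
    exact (congrFun hj ⟨s, hs⟩).trans (map_one _)
  refine ⟨j, GrpCat.ofHom (φ.liftOfSurjective hφ ⟨_, h4⟩), GrpCat.hom_ext ?_⟩
  refine (MonoidHom.cancel_right hφ).1 ?_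
  rw [← h1, GrpCat.hom_comp, GrpCat.hom_ofHom, MonoidHom.comp_assoc]
  have h5 : (φ.liftOfSurjective hφ ⟨_, h4⟩).comp φ = (F.map h).hom.comp (FreeGroup.lift y) :=
    φ.liftOfRightInverse_comp _ _ _
  rw [h5, ← MonoidHom.comp_assoc]
  exact congrArg (fun q => MonoidHom.comp q (FreeGroup.lift y)) (congrArg GrpCat.Hom.hom (c.w h))

/-- The colimit of a sequence of groups is `R`-closed if all systems over groups of the sequence
acquire solutions, and their solutions become equal, later in the sequence. -/
theorem isRClosed_of_isColimit (F : ℕ ⥤ GrpCat.{u})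
    (hF : ∀ (k : ℕ) (t : SolutionTask R (F.obj k)), ∃ (N : ℕ) (h : k ⟶ N), t.Done (F.map h).hom)
    (c : Cocone F) (hc : IsColimit c) : IsRClosed R c.pt := by
  have hw : ∀ {i j : ℕ} (h : i ⟶ j), (c.ι.app j).hom.comp (F.map h).hom = (c.ι.app i).hom :=
    fun h => congrArg GrpCat.Hom.hom (c.w h)
  have hw' : ∀ {i j : ℕ} (h : i ⟶ j) x, (c.ι.app j).hom ((F.map h).hom x) = (c.ι.app i).hom x :=
    fun h x => DFunLike.congr_fun (hw h) x
  have hword : ∀ {n : ℕ} (w : Monoid.Coprod c.pt (FreeGroup (Fin n))), ∃ i : ℕ, ∀ j, i ≤ j →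
      w ∈ (Monoid.Coprod.map (c.ι.app j).hom (MonoidHom.id (FreeGroup (Fin n)))).range := by
    intro n w
    induction w using Monoid.Coprod.induction_on with
    | inl a =>
      obtain ⟨i, hi⟩ := exists_rep_of_isColimit hc fun _ : Unit => a
      refine ⟨i, fun j hj => ?_⟩
      obtain ⟨y, hy⟩ := hi j hj
      exact ⟨Monoid.Coprod.inl (y ()), congrArg Monoid.Coprod.inl (congrFun hy ())⟩
    | inr b => exact ⟨0, fun j _ => ⟨Monoid.Coprod.inr b, rfl⟩⟩
    | mul x y hx hy =>
      obtain ⟨i, hi⟩ := hx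
      obtain ⟨i', hi'⟩ := hy
      exact ⟨max i i', fun j hj => Subgroup.mul_mem _ (hi j (le_of_max_le_left hj))
        (hi' j (le_of_max_le_right hj))⟩
  intro S
  obtain ⟨k, hk⟩ : ∃ k : ℕ, ∀ j, k ≤ j → ∃ S' : NullSystem R (F.obj j),
      S'.map (c.ι.app j).hom = S := by
    choose k hk using fun i => hword (S.w i)
    obtain ⟨k', hk'⟩ := (Set.finite_range k).bddAbove
    exact ⟨k', fun j hj => NullSystem.exists_map_eq_of_mem_range _ S fun i =>
      hk i j ((hk' ⟨i, rfl⟩).trans hj)⟩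
  refine existsUnique_of_exists_of_unique ?_ fun a b ha hb => ?_
  · obtain ⟨S', rfl⟩ := hk k le_rfl
    obtain ⟨N, h, ⟨b, hb⟩, -⟩ := hF k ⟨S', fun _ => 1, fun _ => 1⟩
    have h1 := hb.comp (c.ι.app N).hom
    rw [hw] at h1
    exact ⟨_, NullSystem.isSolution_map_iff.2 h1⟩
  · obtain ⟨i, hi⟩ := exists_rep_of_isColimit hc a
    obtain ⟨i', hi'⟩ := exists_rep_of_isColimit hc b
    obtain ⟨S', rfl⟩ := hk (max k (max i i')) (le_max_left _ _)
    obtain ⟨a, rfl⟩ := hi (max k (max i i')) (by omega)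
    obtain ⟨b, rfl⟩ := hi' (max k (max i i')) (by omega)
    generalize max k (max i i') = l at *
    have hsol : ∀ x : Fin S'.n → F.obj l,
        (S'.map (c.ι.app l).hom).IsSolution ((c.ι.app l).hom ∘ x) →
        ∃ (j : ℕ) (h : l ⟶ j), ∀ (j' : ℕ) (h' : j ⟶ j'),
          S'.IsSolutionIn (F.map (h ≫ h')).hom ((F.map (h ≫ h')).hom ∘ x) := by
      intro x hx
      obtain ⟨j, h, hj⟩ := exists_eq_of_isColimit hc (fun i => x i ^ S'.e)
        (fun i => NullSystem.value (MonoidHom.id _) x (S'.w i)) (funext fun i => by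
          have h1 := NullSystem.isSolution_map_iff.1 hx i
          refine (map_pow _ _ _).trans (h1.trans ?_)
          exact (NullSystem.map_value (MonoidHom.id _) (c.ι.app l).hom x (S'.w i)).symm)
      refine ⟨j, h, fun j' h' => ?_⟩
      have h2 : S'.IsSolutionIn (F.map h).hom ((F.map h).hom ∘ x) := by
        intro i
        refine (map_pow _ _ _).symm.trans ((congrFun hj i).trans ?_)
        exact NullSystem.map_value (MonoidHom.id _) (F.map h).hom x (S'.w i)
      have h3 := h2.comp (F.map h').hom
      rw [F.map_comp]
      exact h3
    obtain ⟨j, h, hj⟩ := hsol a ha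
    obtain ⟨j', h', hj'⟩ := hsol b hb
    have ha' := hj (max j j') (homOfLE (le_max_left _ _))
    have hb' := hj' (max j j') (homOfLE (le_max_right _ _))
    have hh : h ≫ homOfLE (le_max_left j j') = h' ≫ homOfLE (le_max_right j j') := rfl
    rw [← hh] at hb'
    generalize h ≫ homOfLE (le_max_left j j') = p at *
    obtain ⟨N, q, -, hN⟩ := hF _ ⟨S'.map (F.map p).hom, (F.map p).hom ∘ a, (F.map p).hom ∘ b⟩
    have h4 := hN (NullSystem.isSolution_map_iff.2 ha') (NullSystem.isSolution_map_iff.2 hb')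
    funext i
    change (c.ι.app l).hom (a i) = (c.ι.app l).hom (b i)
    rw [← hw' p, ← hw' p, ← hw' q, ← hw' q]
    exact congrArg (c.ι.app N).hom (congrFun h4 i)

/-- Every finitely presented group is the beginning of a sequence in `𝒢^R` with `R`-closed
colimit. -/
theorem exists_sequence_isRClosed (G : GR.{u} R) : ∃ F : ℕ ⥤ GR.{u} R, F.obj 0 = G ∧
    ∀ c : Cocone (F ⋙ GRincl R), IsColimit c → IsRClosed R c.pt := by
  have hcount (X : GR.{u} R) : Countable ((GRincl R).obj X) :=
    Group.IsFinitelyPresented.countable X.2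
  obtain ⟨F, hF, h⟩ := exists_sequence_done
    (T := fun X : GR.{u} R => SolutionTask R ((GRincl R).obj X))
    (Done := fun t f => t.Done ((GRincl R).map f).hom) (fun {X Y} t f => by
      obtain ⟨Z, _, g, hZ, hg, hd⟩ := t.exists_done Y.2 ((GRincl R).map f).hom
      let Z' : GR.{u} R := (⟨GrpCat.of Z, hZ⟩ : {G : GrpCat.{u} // Group.IsFinitelyPresented G})
      let g' : Y ⟶ Z' := ⟨GrpCat.ofHom g, LeftOrthogonal.twoConnected (α := GrpCat.ofHom g) hg⟩
      exact ⟨Z', g', hd⟩) G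
  exact ⟨F, hF, fun c hc => isRClosed_of_isColimit (F ⋙ GRincl R) h c hc⟩

end Countable

/-! ### Extension of natural transformations along sequential colimits -/

section Extension

universe v v' w w'

variable {𝒞 : Type w} [Category.{v} 𝒞] {𝒟 : Type w'} [Category.{v'} 𝒟] {A B C : 𝒞 ⥤ 𝒟}

/-- A presentation of `B(G)` as the colimit of the values of `A` along a sequence in the category
of objects under `G`, compatible with `τ : A ⟶ B`, such that each object under `G` maps to the
sequence. -/
structure SequentialPresentation (τ : A ⟶ B) (G : 𝒞) where
  seq : ℕ ⥤ 𝒞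
  start : G ⟶ seq.obj 0
  cofinal {X : 𝒞} (β : G ⟶ X) :
    ∃ (k : ℕ) (γ : X ⟶ seq.obj k), β ≫ γ = start ≫ seq.map (homOfLE k.zero_le)
  ι : seq ⋙ A ⟶ (Functor.const ℕ).obj (B.obj G)
  isColimit : IsColimit ⟨_, ι⟩
  fac (k : ℕ) : ι.app k ≫ B.map (start ≫ seq.map (homOfLE k.zero_le)) = τ.app (seq.obj k)

/-- The value at `G` of an extension of `σ : A ⟶ C` along `τ : A ⟶ B` is characterized by its
compositions with those morphisms `A(X) ⟶ B(G)` that become `τ_X` under some `β : G ⟶ X`. -/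
theorem SequentialPresentation.existsUnique_hom {τ : A ⟶ B} {G : 𝒞}
    (P : SequentialPresentation τ G) (hB : ∀ {X Y : 𝒞} (f : X ⟶ Y), IsIso (B.map f))
    (hC : ∀ {X Y : 𝒞} (f : X ⟶ Y), IsIso (C.map f)) (σ : A ⟶ C) :
    ∃! s : B.obj G ⟶ C.obj G, ∀ (X : 𝒞) (β : G ⟶ X) (v : A.obj X ⟶ B.obj G),
      v ≫ B.map β = τ.app X → v ≫ s ≫ C.map β = σ.app X := by
  let β (k : ℕ) : G ⟶ P.seq.obj k := P.start ≫ P.seq.map (homOfLE k.zero_le)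
  have hβ {k l : ℕ} (h : k ⟶ l) : β k ≫ P.seq.map h = β l := by
    simp only [β, Category.assoc, ← P.seq.map_comp]
    rfl
  let c : Cocone (P.seq ⋙ A) := ⟨C.obj G,
    { app := fun k => σ.app (P.seq.obj k) ≫ inv (C.map (β k))
      naturality := fun k l h => by
        have h1 : inv (C.map (β k)) = C.map (P.seq.map h) ≫ inv (C.map (β l)) := by
          rw [IsIso.eq_comp_inv, IsIso.inv_comp_eq, ← C.map_comp, hβ]
        simp [h1] }⟩
  have hfac (k : ℕ) : P.ι.app k ≫ P.isColimit.desc c ≫ C.map (β k) = σ.app _ := by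
    rw [← Category.assoc]
    refine (congrArg (· ≫ C.map (β k)) (P.isColimit.fac c k)).trans ?_
    exact (Category.assoc _ _ _).trans (by rw [IsIso.inv_hom_id, Category.comp_id])
  refine ⟨P.isColimit.desc c, fun X δ v hv => ?_, fun s hs => ?_⟩
  · obtain ⟨k, γ, hγ⟩ := P.cofinal δ
    have h1 : v = A.map γ ≫ P.ι.app k := by
      rw [← cancel_mono (B.map (β k)), Category.assoc, P.fac, τ.naturality, ← hv, Category.assoc,
        ← B.map_comp, hγ]
    rw [← cancel_mono (C.map γ), Category.assoc, Category.assoc, ← C.map_comp, hγ, h1,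
      Category.assoc, hfac, σ.naturality]
  · refine P.isColimit.hom_ext fun k => ?_
    change P.ι.app k ≫ s = P.ι.app k ≫ _
    rw [← cancel_mono (C.map (β k)), Category.assoc, Category.assoc, hfac]
    exact hs _ _ _ (P.fac k)

/-- Let `B` and `C` invert all morphisms. If each `B(G)` is a colimit of values of `A` along a
cofinal sequence of objects under `G`, then natural transformations from `A` to `C` extend
uniquely to `B`. -/
theorem existsUnique_extension_of_sequentialPresentation {τ : A ⟶ B}
    (P : ∀ G, SequentialPresentation τ G) (hB : ∀ {X Y : 𝒞} (f : X ⟶ Y), IsIso (B.map f))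
    (hC : ∀ {X Y : 𝒞} (f : X ⟶ Y), IsIso (C.map f)) (σ : A ⟶ C) :
    ∃! σ' : B ⟶ C, τ ≫ σ' = σ := by
  choose s hs hu using fun G => (P G).existsUnique_hom hB hC σ
  refine ⟨{ app := s, naturality := fun G K α => ?_ }, ?_, fun σ' hσ' => ?_⟩
  · rw [← IsIso.eq_inv_comp]
    refine (hu K _ fun X β v hv => ?_).symm
    have h := hs G X (α ≫ β) (v ≫ inv (B.map α)) (by simp [hv])
    simpa using h
  · ext G
    simpa using hs G G (𝟙 G) (τ.app G) (by simp)
  · ext G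
    refine hu G _ fun X β v hv => ?_
    rw [← σ'.naturality, ← Category.assoc, hv, ← hσ']
    rfl

/-- Extensions of injective natural transformations along a sequential presentation are
injective. -/
theorem SequentialPresentation.injective_of_comp {A B C : 𝒞 ⥤ GrpCat.{u}} {τ : A ⟶ B} {G : 𝒞}
    (P : SequentialPresentation τ G) (σ : B ⟶ C)
    (hσ : ∀ X, Function.Injective ((τ ≫ σ).app X)) : Function.Injective (σ.app G) := by
  refine (injective_iff_map_eq_one (σ.app G).hom).2 fun x hx => ?_
  obtain ⟨k, a, rfl⟩ := Concrete.isColimit_exists_rep (P.seq ⋙ A) P.isColimit x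
  have h1 : P.ι.app k ≫ σ.app G ≫ C.map (P.start ≫ P.seq.map (homOfLE k.zero_le)) =
      (τ ≫ σ).app (P.seq.obj k) := by
    rw [← σ.naturality, ← Category.assoc, P.fac]
    rfl
  have h2 : ((τ ≫ σ).app (P.seq.obj k)).hom a = 1 := by
    rw [← h1]
    exact (congrArg (C.map _).hom hx).trans (map_one _)
  have h3 : a = 1 := hσ _ (h2.trans (map_one _).symm)
  rw [h3]
  exact map_one (P.ι.app k).hom

end Extension

/-! ### Universal containers -/

namespace IFunctor

variable {R : Subring ℚ} {H F : IFunctor.{u} R}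

/-- The natural transformation underlying a morphism of I-functors. -/
def toNatTrans (τ : H ⟶ F) : H.toFunctor ⟶ F.toFunctor where
  app := app τ
  naturality _ _ α := Hom.naturality τ α

/-- A container is universal if each `F(G)` is the colimit of a cofinal sequence of values of
`H`. -/
theorem IsContainer.isUniversalContainer {τ : H ⟶ F} (hτ : IsContainer τ)
    (P : ∀ G, SequentialPresentation (toNatTrans τ) G) : IsUniversalContainer τ := by
  refine ⟨hτ, fun F' σ hσ => ?_⟩
  have hF {X Y : GR.{u} R} (f : X ⟶ Y) : IsIso (F.toFunctor.map f) := hτ.2 _ (omega_of_GR f)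
  have hF' {X Y : GR.{u} R} (f : X ⟶ Y) : IsIso (F'.toFunctor.map f) := hσ.2 _ (omega_of_GR f)
  obtain ⟨σ', h, hu⟩ := existsUnique_extension_of_sequentialPresentation P hF hF' (toNatTrans σ)
  have happ (G : GR.{u} R) : app τ G ≫ σ'.app G = app σ G := congrArg (fun q => q.app G) h
  let ρ : F ⟶ F' := Hom.mk (fun G => σ'.app G) (fun α => σ'.naturality α) fun G =>
    (congrArg (· ≫ σ'.app G) (Hom.p_comp τ G)).symm.trans <|
      (Category.assoc (H.p _) (app τ G) (σ'.app G)).trans <|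
        (congrArg (H.p _ ≫ ·) (happ G)).trans (Hom.p_comp σ G)
  refine ⟨ρ, ⟨fun G => (P G).injective_of_comp σ' ?_, Hom.ext (funext happ)⟩, fun ρ' hρ' => ?_⟩
  · rw [h]
    exact hσ.1
  · have h1 := hu (toNatTrans ρ') (by
      ext G : 2
      exact congrArg (fun q => app q G) hρ'.2)
    exact Hom.ext (funext fun G => congrArg (fun q => q.app G) h1)

end IFunctor

/-! ### `R`-closures of finitely presented groups as sequential colimits -/

section Closure

variable {R : Subring ℚ}

theorem TwoConnected.of_comp {G X Y : GrpCat.{u}} {β : G ⟶ X} {γ : X ⟶ Y}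
    (hβ : TwoConnected R β) (h : TwoConnected R (β ≫ γ)) : TwoConnected R γ := by
  have h' : ∀ n, ⇑(homologyMapWith R (β ≫ γ).hom n) =
      ⇑(homologyMapWith R γ.hom n) ∘ ⇑(homologyMapWith R β.hom n) := by
    intro n
    funext x
    rw [GrpCat.hom_comp, homologyMapWith_comp]
    rfl
  obtain ⟨h₁, h₂⟩ := h
  rw [h'] at h₁ h₂
  exact ⟨(Function.Bijective.of_comp_iff _ hβ.1).1 h₁, h₂.of_comp⟩

theorem Omega.existsUnique_comp {π G : GrpCat.{u}} {α : π ⟶ G} (hα : Omega R α) {A : GrpCat.{u}}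
    (hA : IsRClosed R A) (φ : π ⟶ A) : ∃! χ : G ⟶ A, α ≫ χ = φ := by
  obtain ⟨χ, h, hu⟩ := Omega.existsUnique_extension hα hA φ.hom
  exact ⟨GrpCat.ofHom χ, GrpCat.hom_ext h, fun χ' h' =>
    GrpCat.hom_ext (hu _ (congrArg GrpCat.Hom.hom h'))⟩

theorem isIso_map_of_omega {E : GrpCat.{u} ⥤ GrpCat.{u}} {i : 𝟭 GrpCat.{u} ⟶ E}
    (hi : ∀ G, IsRClosure R (i.app G)) {π G : GrpCat.{u}} (α : π ⟶ G) (hα : Omega R α) :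
    IsIso (E.map α) := by
  have hnat : α ≫ i.app G = i.app π ≫ E.map α := i.naturality α
  obtain ⟨χ, hχ, -⟩ := hα.existsUnique_comp (hi π).1 (i.app π)
  obtain ⟨d, hd, -⟩ := (hi G).2 _ (hi π).1 χ
  refine ⟨d, ((hi π).2 _ (hi π).1 (i.app π)).unique ?_ (Category.comp_id _),
    ((hi G).2 _ (hi G).1 (i.app G)).unique ?_ (Category.comp_id _)⟩
  · rw [← Category.assoc, ← hnat, Category.assoc, hd, hχ]
  · rw [← Category.assoc, hd]
    refine (hα.existsUnique_comp (hi G).1 (α ≫ i.app G)).unique ?_ rfl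
    rw [← Category.assoc, hχ, hnat]

/-- A presentation of a homomorphism `i : G → K` from a finitely presented group as the
homomorphism to the direct limit of a sequence in `𝒢^R`. -/
structure SequentialClosure (G : GR.{u} R) {K : GrpCat.{u}} (i : (GRincl R).obj G ⟶ K) where
  seq : ℕ ⥤ GR.{u} R
  start : G ⟶ seq.obj 0
  ι : seq ⋙ GRincl R ⟶ (Functor.const ℕ).obj K
  isColimit : IsColimit (Cocone.mk K ι)
  fac : (GRincl R).map start ≫ ι.app 0 = i

theorem IsRClosure.nonempty_sequentialClosure {G : GR.{u} R} {K : GrpCat.{u}}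
    {i : (GRincl R).obj G ⟶ K} (hi : IsRClosure R i) : Nonempty (SequentialClosure G i) := by
  obtain ⟨F, rfl, hF⟩ := exists_sequence_isRClosed G
  let c := GrpCat.FilteredColimits.colimitCocone.{0, u} (F ⋙ GRincl R)
  let hc : IsColimit c := GrpCat.FilteredColimits.colimitCoconeIsColimit _
  have hpt := hF c hc
  let f (k : ℕ) : F.obj 0 ⟶ F.obj k := F.map (homOfLE k.zero_le)
  have hf {k l : ℕ} (h : k ⟶ l) : (GRincl R).map (f k) ≫ (GRincl R).map (F.map h) =
      (GRincl R).map (f l) := by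
    rw [← Functor.map_comp, ← F.map_comp]
    rfl
  have hw (k : ℕ) : (GRincl R).map (f k) ≫ c.ι.app k = c.ι.app 0 := c.w (homOfLE k.zero_le)
  choose χ hχ hu using fun k => (omega_of_GR (f k)).existsUnique_comp hi.1 i
  have hχ0 : χ 0 = i := by
    have h : f 0 = 𝟙 _ := F.map_id 0
    rw [← hχ 0, h]
    exact (Category.id_comp _).symm
  let ι : F ⋙ GRincl R ⟶ (Functor.const ℕ).obj K :=
    { app := χ
      naturality := fun k l h => by
        refine (hu k _ ?_).trans (Category.comp_id _).symm
        change (GRincl R).map (f k) ≫ (GRincl R).map (F.map h) ≫ χ l = i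
        rw [← Category.assoc, hf, hχ] }
  obtain ⟨e, he, -⟩ := hi.2 c.pt hpt (c.ι.app 0)
  let d : c.pt ⟶ K := hc.desc ⟨K, ι⟩
  have hd (k : ℕ) : c.ι.app k ≫ d = χ k := hc.fac ⟨K, ι⟩ k
  have hχe (k : ℕ) : χ k ≫ e = c.ι.app k := by
    refine ((omega_of_GR (f k)).existsUnique_comp hpt (c.ι.app 0)).unique ?_ (hw k)
    rw [← Category.assoc, hχ, he]
  let φ : c.pt ≅ K :=
    { hom := d
      inv := e
      hom_inv_id := hc.hom_ext fun k => by
        rw [← Category.assoc, hd, hχe, Category.comp_id]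
      inv_hom_id := by
        refine (hi.2 K hi.1 i).unique ?_ (Category.comp_id _)
        rw [← Category.assoc, he, hd, hχ0] }
  refine ⟨⟨F, 𝟙 _, ι, hc.ofIsoColimit (Cocone.ext φ hd), ?_⟩⟩
  exact (Category.id_comp _).trans hχ0

namespace SequentialClosure

variable {G : GR.{u} R} {K : GrpCat.{u}} {i : (GRincl R).obj G ⟶ K}

/-- The morphism from `G` to a group of the sequence. -/
def toSeq (D : SequentialClosure G i) (k : ℕ) : G ⟶ D.seq.obj k :=
  D.start ≫ D.seq.map (homOfLE k.zero_le)

theorem toSeq_ι (D : SequentialClosure G i) (k : ℕ) :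
    (GRincl R).map (D.toSeq k) ≫ D.ι.app k = i := by
  have h : (GRincl R).map (D.seq.map (homOfLE k.zero_le)) ≫ D.ι.app k = D.ι.app 0 :=
    Cocone.w (Cocone.mk K D.ι) (homOfLE k.zero_le)
  rw [toSeq, Functor.map_comp, Category.assoc, h, D.fac]

/-- Precomposition with a morphism in `𝒢^R`. -/
def precomp {G' : GR.{u} R} (α : G' ⟶ G) (D : SequentialClosure G i) :
    SequentialClosure G' ((GRincl R).map α ≫ i) where
  seq := D.seq
  start := α ≫ D.start
  ι := D.ι
  isColimit := D.isColimit
  fac := by rw [Functor.map_comp, Category.assoc, D.fac]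

/-- Each group in `𝒢^R` under `G` maps to some group of a sequence whose direct limit is the
`R`-closure of `G`. -/
theorem exists_comp_eq {G : GR.{u} R} {K : GrpCat.{u}}
    {j : (GRincl R).obj G ⟶ K} (D : SequentialClosure G j) (hK : IsRClosed R K) {X : GR.{u} R}
    (β : G ⟶ X) : ∃ (k : ℕ) (γ : X ⟶ D.seq.obj k), β ≫ γ = D.toSeq k := by
  obtain ⟨χ, hχ, -⟩ := (omega_of_GR β).existsUnique_comp hK j
  obtain ⟨l, g, hg⟩ := exists_factorization_of_isColimit D.isColimit X.2 χ
  have h0 : ((GRincl R).map β ≫ g) ≫ D.ι.app l = (GRincl R).map (D.toSeq l) ≫ D.ι.app l :=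
    (Category.assoc ((GRincl R).map β) g (D.ι.app l)).trans <|
      (congrArg ((GRincl R).map β ≫ ·) hg).trans (hχ.trans (D.toSeq_ι l).symm)
  obtain ⟨k, h, hk⟩ := exists_comp_map_eq_of_isColimit D.isColimit (omega_of_GR β).1 _ _ h0
  have h1 : (GRincl R).map β ≫ g ≫ (GRincl R).map (D.seq.map h) =
      (GRincl R).map (D.toSeq k) := by
    refine (Category.assoc ((GRincl R).map β) g ((GRincl R).map (D.seq.map h))).symm.trans ?_
    refine hk.trans (((GRincl R).map_comp (D.toSeq l) (D.seq.map h)).symm.trans ?_)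
    rw [SequentialClosure.toSeq, Category.assoc, ← D.seq.map_comp]
    rfl
  exact ⟨k, ⟨_, TwoConnected.of_comp β.property (h1 ▸ (D.toSeq k).property)⟩,
    InducedWideCategory.Hom.ext h1⟩

/-- The groups of the sequence that starts with `G`. -/
def consObj (D : SequentialClosure G i) : ℕ → GR.{u} R
  | 0 => G
  | k + 1 => D.seq.obj k

/-- The morphisms of the sequence that starts with `G`. -/
def consMap (D : SequentialClosure G i) : ∀ k, D.consObj k ⟶ D.consObj (k + 1)
  | 0 => D.start
  | k + 1 => D.seq.map (homOfLE (Nat.le_add_right k 1))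

/-- The sequence that starts with `G`. -/
def cons (D : SequentialClosure G i) : ℕ ⥤ GR.{u} R := Functor.ofSequence D.consMap

theorem cons_map (D : SequentialClosure G i) (k : ℕ) :
    D.cons.map (homOfLE (Nat.le_add_right k 1)) = D.consMap k :=
  Functor.ofSequence_map_homOfLE_succ _ _

/-- The homomorphisms to the direct limit from the sequence that starts with `G`. -/
def consιApp (D : SequentialClosure G i) : ∀ k, (D.cons ⋙ GRincl R).obj k ⟶ K
  | 0 => i
  | k + 1 => D.ι.app k

/-- The cocone of the sequence that starts with `G`. -/
def consCocone (D : SequentialClosure G i) : Cocone (D.cons ⋙ GRincl R) where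
  pt := K
  ι := NatTrans.ofSequence D.consιApp fun k => by
    rw [Functor.comp_map, cons_map]
    cases k with
    | zero => exact D.fac.trans (Category.comp_id _).symm
    | succ k => exact D.ι.naturality (homOfLE (Nat.le_add_right k 1))

/-- The direct limit does not change if `G` is prepended to the sequence. -/
def isColimitConsCocone (D : SequentialClosure G i) : IsColimit D.consCocone := by
  have hw (s : Cocone (D.cons ⋙ GRincl R)) (k : ℕ) :
      (GRincl R).map (D.consMap k) ≫ s.ι.app (k + 1) = s.ι.app k := by
    have h := s.w (homOfLE (Nat.le_add_right k 1))
    rwa [Functor.comp_map, cons_map] at h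
  let t (s : Cocone (D.cons ⋙ GRincl R)) : Cocone (D.seq ⋙ GRincl R) := ⟨s.pt,
    NatTrans.ofSequence (fun k => s.ι.app (k + 1)) fun k =>
      (hw s (k + 1)).trans (Category.comp_id _).symm⟩
  have hfac (s : Cocone (D.cons ⋙ GRincl R)) (k : ℕ) :
      D.ι.app k ≫ D.isColimit.desc (t s) = s.ι.app (k + 1) := D.isColimit.fac (t s) k
  refine ⟨fun s => D.isColimit.desc (t s), fun s k => ?_, fun s m hm => ?_⟩
  · cases k with
    | zero =>
      refine (congrArg (· ≫ D.isColimit.desc (t s)) D.fac).symm.trans ?_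
      refine (Category.assoc _ (D.ι.app 0) (D.isColimit.desc (t s))).trans ?_
      exact (congrArg ((GRincl R).map D.start ≫ ·) (hfac s 0)).trans (hw s 0)
    | succ k => exact hfac s k
  · exact D.isColimit.hom_ext fun k => (hm (k + 1)).trans (hfac s k).symm

end SequentialClosure

end Closure

/-! ### The container given by the `R`-closure -/

namespace IFunctor

variable {R : Subring ℚ} {H : IFunctor.{u} R}

/-- If `H` commutes with limits, then `H(i)` exists and is injective for homomorphisms `i` from
finitely presented groups to direct limits of sequences in `𝒢^R`. -/
theorem CommutesWithLimits.dom_and_injective (hH : H.CommutesWithLimits) {G : GR.{u} R}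
    {K : GrpCat.{u}} {i : (GRincl R).obj G ⟶ K} (D : SequentialClosure G i) :
    ∃ h : H.dom i, Function.Injective (H.map i h) := by
  obtain ⟨hc, ⟨hcol⟩⟩ := hH D.cons D.consCocone D.isColimitConsCocone
  refine ⟨hc 0, fun x y hxy => ?_⟩
  obtain ⟨k, h, hk⟩ := (hcol.eq_iff' (i := 0) x y).1 hxy
  exact H.map_injective _ (omega_of_GR (D.cons.map h)) hk

variable {E : GrpCat.{u} ⥤ GrpCat.{u}} {i : 𝟭 GrpCat.{u} ⟶ E}

theorem CommutesWithLimits.dom_comp_closure (hH : H.CommutesWithLimits)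
    (hi : ∀ G, IsRClosure R (i.app G)) {G K : GR.{u} R} (α : G ⟶ K) :
    H.dom ((GRincl R).map α ≫ i.app ((GRincl R).obj K)) := by
  obtain ⟨D⟩ := (hi ((GRincl R).obj K)).nonempty_sequentialClosure
  exact (hH.dom_and_injective (D.precomp α)).1

theorem CommutesWithLimits.dom_closure (hH : H.CommutesWithLimits)
    (hi : ∀ G, IsRClosure R (i.app G)) (G : GR.{u} R) :
    H.dom (i.app ((GRincl R).obj G)) := by
  obtain ⟨D⟩ := (hi ((GRincl R).obj G)).nonempty_sequentialClosure
  exact (hH.dom_and_injective D).1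

/-- The morphism of I-functors with components `H(i_G)`. -/
def closureHom (hH : H.CommutesWithLimits) (hi : ∀ G, IsRClosure R (i.app G)) :
    H ⟶ H.precomp E i fun _ _ => isIso_map_of_omega hi :=
  Hom.mk (fun G => H.map (i.app ((GRincl R).obj G)) (hH.dom_closure hi G))
    (fun {G K} α => by
      have hE := isIso_map_of_omega hi _ (omega_of_GR α)
      have hnat : (GRincl R).map α ≫ i.app _ = i.app _ ≫ E.map ((GRincl R).map α) :=
        i.naturality _
      have h1 := hH.dom_comp_closure hi α
      refine (H.map_comp _ _ (H.dom_of_omega _ (omega_of_GR α)) (hH.dom_closure hi K) h1).symm.trans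
        ((H.map_congr hnat h1 (hnat ▸ h1)).trans ?_)
      exact H.map_comp _ _ (hH.dom_closure hi G) (H.dom_of_isIso _ hE) _)
    fun G => (H.p_naturality _ (hH.dom_closure hi G)).symm

theorem isContainer_closureHom (hH : H.CommutesWithLimits) (hi : ∀ G, IsRClosure R (i.app G)) :
    IsContainer (closureHom hH hi) := by
  refine ⟨fun G => ?_, fun α hα => H.map_isIso _ (isIso_map_of_omega hi α hα)⟩
  obtain ⟨D⟩ := (hi ((GRincl R).obj G)).nonempty_sequentialClosure
  exact (hH.dom_and_injective D).2

theorem nonempty_sequentialPresentation_closureHom (hH : H.CommutesWithLimits)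
    (hi : ∀ G, IsRClosure R (i.app G)) (G : GR.{u} R) :
    Nonempty (SequentialPresentation (toNatTrans (closureHom hH hi)) G) := by
  obtain ⟨D⟩ := (hi ((GRincl R).obj G)).nonempty_sequentialClosure
  obtain ⟨hc, ⟨hcol⟩⟩ := hH D.seq _ D.isColimit
  refine ⟨⟨D.seq, D.start, fun β => D.exists_comp_eq (hi _).1 β,
    (H.mapCocone D.seq _ hc).ι, hcol, fun k => ?_⟩⟩
  have hE := isIso_map_of_omega hi _ (omega_of_GR (D.toSeq k))
  have h1 : D.ι.app k ≫ E.map ((GRincl R).map (D.toSeq k)) =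
      i.app ((GRincl R).obj (D.seq.obj k)) := by
    refine ((omega_of_GR (D.toSeq k)).existsUnique_comp (hi _).1
      ((GRincl R).map (D.toSeq k) ≫ i.app _)).unique ?_ rfl
    refine (Category.assoc _ (D.ι.app k) (E.map ((GRincl R).map (D.toSeq k)))).symm.trans ?_
    rw [D.toSeq_ι]
    exact (i.naturality _).symm
  have h2 := hH.dom_closure hi (D.seq.obj k)
  refine (H.map_comp _ _ (hc k) (H.dom_of_isIso _ hE) (h1 ▸ h2)).symm.trans ?_
  exact H.map_congr h1 _ h2

end IFunctor

theorem mainTheorem1 (R : Subring ℚ) (H : IFunctor.{u} R) (hH : H.CommutesWithLimits) :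
    (∃ (E : GrpCat.{u} ⥤ GrpCat.{u}) (i : 𝟭 GrpCat.{u} ⟶ E), ∀ G, IsRClosure R (i.app G)) ∧
    ∀ (E : GrpCat.{u} ⥤ GrpCat.{u}) (i : 𝟭 GrpCat.{u} ⟶ E), (∀ G, IsRClosure R (i.app G)) →
      ∃ (hE : ∀ (π G : GrpCat.{u}) (α : π ⟶ G), Omega R α → IsIso (E.map α))
        (τ : H ⟶ H.precomp E i hE),
        (∀ G : GR.{u} R, ∃ h : H.dom (i.app ((GRincl R).obj G)),
          IFunctor.app τ G = H.map (i.app ((GRincl R).obj G)) h) ∧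
        IFunctor.IsUniversalContainer τ := by
  refine ⟨⟨RClosure.functor R, RClosure.unit R, RClosure.isRClosure_unit⟩, fun E i hi => ?_⟩
  refine ⟨fun _ _ => isIso_map_of_omega hi, IFunctor.closureHom hH hi,
    fun G => ⟨hH.dom_closure hi G, rfl⟩, ?_⟩
  exact (IFunctor.isContainer_closureHom hH hi).isUniversalContainer fun G =>
    (IFunctor.nonempty_sequentialPresentation_closureHom hH hi G).some
end
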